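/- Let $I$ be a finite set with $|I|\ge 2$ and for each $i\in I$ let $S_i:[0,1]^2\to[0,1]^2$ be a contraction (for the Euclidean norm) of the form $S_i(a_1,a_2)=(f_i(a_1),g_i(a_1,a_2))$, where $f_i$ and $g_i$ are $C^{1+\alpha}$ on $[0,1]$ and $[0,1]^2$ for some $0<\alpha\le 1$ (one-sided derivatives at the boundary). Let $F\subseteq[0,1]^2$ be the attractor, i.e. the unique non-empty compact set with $F=\bigcup_{i\in I}S_i(F)$, and let $\pi(x,y)=x$. Assume the domination condition: there is $d>0$ such that for every $i\in I$ $$\inf_{\mathbf a\in[0,1]^2} f_{i,x}(\mathbf a)>\sup_{\mathbf a\in[0,1]^2} g_{i,y}(\mathbf a)\ge\inf_{\mathbf a\in[0,1]^2} g_{i,y}(\mathbf a)\ge d .$$ For a word $\mathbf i=(i_1,\dots,i_k)\in I^k$ put $S_{\mathbf i}=S_{i_1}\circ\cdots\circ S_{i_k}$ and let $\alpha_1(D_{\mathbf a}S_{\mathbf i})\ge\alpha_2(D_{\mathbf a}S_{\mathbf i})$ be the singular values of its Jacobian matrix at $\mathbf a$. For a probability vector $(p_i)_{i\in I}$ with all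 $p_i\in(0,1)$ let $p(\mathbf i)=p_{i_1}\cdots p_{i_k}$ and let $\mu$ be the Borel probability measure supported on $F$ with $\mu=\sum_i p_i\,\mu\circ S_i^{-1}$. For $q\ge0$ let $$\beta(q)=\lim_{\delta\to0}\frac{\log\sum_{Q}(\pi\mu)(Q)^q}{-\log\delta}$$ be the $L^q$-spectrum of the projected measure $\pi\mu=\mu\circ\pi^{-1}$, where $Q$ runs over the intervals $[m\delta,(m+1)\delta]$, $m\in\mathbb Z$, of positive $\pi\mu$-measure. Let $$P(s,q)=\lim_{k\to\infty}\Big(\sum_{\mathbf i\in I^k}p(\mathbf i)^q\,\alpha_1(D_{\mathbf a}S_{\mathbf i})^{\beta(q)}\,\alpha_2(D_{\mathbf a}S_{\mathbf i})^{s-\beta(q)}\Big)^{1/k}\qquad(s\in\mathbb R,\ \mathbf a\in[0,1]^2),$$ and let $\gamma(q)$ be the unique real number with $P(\gamma(q),q)=1$. Then $\beta(0)$ and $\gamma(0)$ are well defined and do not depend on the choice of $(p_i)$: the box dimension of $\pi F$ exists, the limit defining $\beta(0)$ exists and $\beta(0)=\dim_B\pi F$, the limit $P(s,0)$ exists for every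 $s\in\mathbb R$ and is independent of $\mathbf a$, and $P(s,0)=1$ for exactly one real $s$, namely $s=\gamma(0)$. Moreover: (1) $\overline{\dim}_B F\le\gamma(0)$. (2) If $F$ also satisfies the rectangular open set condition, i.e. the sets $S_i((0,1)^2)$, $i\in I$, are pairwise disjoint subsets of $(0,1)^2$, then the box dimension of $F$ exists and $\dim_B F=\gamma(0)$. -/

import Mathlib

open Set Filter Topology MeasureTheory
open scoped NNReal ENNReal

/-- The plane with the Euclidean norm. -/
abbrev Plane : Type := EuclideanSpace ℝ (Fin 2)

/-- The closed unit square `[0,1]²`. -/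
def unitSquare : Set Plane := {a | ∀ j, a j ∈ Icc (0 : ℝ) 1}

/-- The open unit square `(0,1)²`. -/
def openUnitSquare : Set Plane := {a | ∀ j, a j ∈ Ioo (0 : ℝ) 1}

/-- The projection `π` onto the `x`-axis. -/
def projX (a : Plane) : ℝ := a 0

/-- `φ` is `C^{1+α}` on `s`: it is differentiable on `s` (one-sidedly at boundary points, i.e. within
`s`) and its derivative is `α`-Hölder on `s`. -/
def C1HolderOn {E : Type*} [NormedAddCommGroup E] [NormedSpace ℝ E]
    (α : ℝ≥0) (φ : E → ℝ) (s : Set E) : Prop :=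
  DifferentiableOn ℝ φ s ∧ ∃ B : ℝ≥0, HolderOnWith B α (fderivWithin ℝ φ s) s

/-- An iterated function system of maps `S_i (a₁, a₂) = (f_i a₁, g_i (a₁, a₂))` that are contractions
of `[0,1]²` into itself with `C^{1+α}` components, `0 < α ≤ 1`. Only the values of `f i` on `[0,1]`
and of `g i` on `[0,1]²` matter. That the components `f i`, `g i` are themselves contractions
is a consequence of `contracting`. -/
structure NonlinearIFS (I : Type*) where
  f : I → ℝ → ℝ
  g : I → Plane → ℝ
  mapsTo : ∀ i, MapsTo (fun a : Plane => (!₂[f i (a 0), g i a] : Plane)) unitSquare unitSquare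
  contracting : ∀ i, ∃ c : ℝ≥0, c < 1 ∧
    LipschitzOnWith c (fun a : Plane => (!₂[f i (a 0), g i a] : Plane)) unitSquare
  regular : ∃ α : ℝ≥0, 0 < α ∧ α ≤ 1 ∧
    ∀ i, C1HolderOn α (f i) (Icc 0 1) ∧ C1HolderOn α (g i) unitSquare

namespace NonlinearIFS

variable {I : Type*}

/-- The map `S_i`. -/
def map (S : NonlinearIFS I) (i : I) : Plane → Plane := fun a => !₂[S.f i (a 0), S.g i a]

/-- `F` is the nonlinear attractor of the system: the non-empty compact subset of `[0,1]²` with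
`F = ⋃ i, S_i F`. -/
structure IsAttractor (S : NonlinearIFS I) (F : Set Plane) : Prop where
  nonempty : F.Nonempty
  isCompact : IsCompact F
  subset : F ⊆ unitSquare
  eq_iUnion : F = ⋃ i, S.map i '' F

/-- The partial derivative `f_{i,x}`. -/
noncomputable def fx (S : NonlinearIFS I) (i : I) (a : Plane) : ℝ :=
  derivWithin (S.f i) (Icc 0 1) (a 0)

/-- The partial derivative `g_{i,y}`. -/
noncomputable def gy (S : NonlinearIFS I) (i : I) (a : Plane) : ℝ :=
  fderivWithin ℝ (S.g i) unitSquare a (EuclideanSpace.single 1 1)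

/-- The domination condition: there is `d > 0` with
`inf f_{i,x} > sup g_{i,y} ≥ inf g_{i,y} ≥ d` for every `i`. -/
def Dominated (S : NonlinearIFS I) : Prop :=
  ∃ d : ℝ, 0 < d ∧ ∀ i,
    sSup (S.gy i '' unitSquare) < sInf (S.fx i '' unitSquare) ∧
    sInf (S.gy i '' unitSquare) ≤ sSup (S.gy i '' unitSquare) ∧
    d ≤ sInf (S.gy i '' unitSquare)

/-- The rectangular open set condition: the sets `S_i ((0,1)²)`, `i ∈ I`, are pairwise disjoint
subsets of `(0,1)²`. -/
def ROSC (S : NonlinearIFS I) : Prop :=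
  (∀ i, S.map i '' openUnitSquare ⊆ openUnitSquare) ∧
  ∀ i j, i ≠ j → Disjoint (S.map i '' openUnitSquare) (S.map j '' openUnitSquare)

/-- `S_w = S_{w 0} ∘ ⋯ ∘ S_{w (k-1)}` for a word `w` of length `k`. -/
def wordMap (S : NonlinearIFS I) : {k : ℕ} → (Fin k → I) → Plane → Plane
  | 0, _ => id
  | _ + 1, w => S.map (w 0) ∘ S.wordMap (Fin.tail w)

/-- The derivative `D_a S_w` (taken within the square). -/
noncomputable def jacobian (S : NonlinearIFS I) {k : ℕ} (w : Fin k → I) (a : Plane) :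
    Plane →L[ℝ] Plane :=
  fderivWithin ℝ (S.wordMap w) unitSquare a

/-- The larger singular value `α₁ (D_a S_w)`. -/
noncomputable def alpha₁ (S : NonlinearIFS I) {k : ℕ} (w : Fin k → I) (a : Plane) : ℝ :=
  (S.jacobian w a).toLinearMap.singularValues 0

/-- The smaller singular value `α₂ (D_a S_w)`. -/
noncomputable def alpha₂ (S : NonlinearIFS I) {k : ℕ} (w : Fin k → I) (a : Plane) : ℝ :=
  (S.jacobian w a).toLinearMap.singularValues 1

/-- The `q`-modified singular value function
`ψ_a^{s,q} (w) = p(w)^q α₁(D_a S_w)^β α₂(D_a S_w)^(s - β)`, where `p(w) = p_{w 0} ⋯ p_{w (k-1)}`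
and where `β` stands for the value `β(q)`. -/
noncomputable def psi (S : NonlinearIFS I) (p : I → ℝ) (β s q : ℝ) (a : Plane)
    {k : ℕ} (w : Fin k → I) : ℝ :=
  (∏ j, p (w j)) ^ q * S.alpha₁ w a ^ β * S.alpha₂ w a ^ (s - β)

/-- `Ψ_{a,k}^{s,q}`, the sum of `ψ_a^{s,q}` over all words of length `k`. -/
noncomputable def Psi [Fintype I] (S : NonlinearIFS I) (p : I → ℝ) (β s q : ℝ) (a : Plane)
    (k : ℕ) : ℝ :=
  ∑ w : Fin k → I, S.psi p β s q a w

/-- `P` is the function `s ↦ P(s, q)`: for every base point `a ∈ [0,1]²` and every `s`,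
`P(s, q) = lim_k (Ψ_{a,k}^{s,q})^{1/k}`. -/
def IsPressure [Fintype I] (S : NonlinearIFS I) (p : I → ℝ) (β q : ℝ) (P : ℝ → ℝ) : Prop :=
  ∀ a ∈ unitSquare, ∀ s : ℝ,
    Tendsto (fun k : ℕ => S.Psi p β s q a k ^ (1 / (k : ℝ))) atTop (𝓝 (P s))

/-- `γ` is the value `γ(q)` of the moment scaling function: `P(·, q)` is well defined and
`γ` is the unique real number with `P(γ, q) = 1`. -/
def IsMomentScaling [Fintype I] (S : NonlinearIFS I) (p : I → ℝ) (β q γ : ℝ) : Prop :=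
  ∃ P : ℝ → ℝ, S.IsPressure p β q P ∧ ∀ s : ℝ, P s = 1 ↔ s = γ

/-- `μ` is the nonlinear measure of the system and the weights `p`: the Borel probability
measure supported on the attractor `F` with `μ = ∑ p_i μ ∘ S_i⁻¹`. -/
structure IsNonlinearMeasure [Fintype I] (S : NonlinearIFS I) (F : Set Plane) (p : I → ℝ)
    (μ : Measure Plane) : Prop where
  isProbabilityMeasure : IsProbabilityMeasure μ
  compl_eq_zero : μ Fᶜ = 0
  eq_sum : μ = ∑ i, ENNReal.ofReal (p i) • μ.map (S.map i)

end NonlinearIFS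

/-- Probability vectors with all entries in `(0,1)`. -/
def IsProbVector {I : Type*} [Fintype I] (p : I → ℝ) : Prop :=
  (∀ i, p i ∈ Ioo (0 : ℝ) 1) ∧ ∑ i, p i = 1

/-- The closed intervals `[mδ, (m+1)δ]`, `m ∈ ℤ`, of the `δ`-mesh on `ℝ`. -/
def meshInterval (δ : ℝ) (m : ℤ) : Set ℝ := Icc (m * δ) ((m + 1) * δ)

/-- The moment sum `∑ ν(Q)^q` over the intervals `Q` of the `δ`-mesh with `ν(Q) > 0`. -/
noncomputable def momentSum (ν : Measure ℝ) (q δ : ℝ) : ℝ :=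
  ∑' m : {m : ℤ // 0 < ν (meshInterval δ m)}, ν.real (meshInterval δ m) ^ q

/-- The `L^q`-spectrum of the measure `ν` on `ℝ` exists at `q` and equals `τ`. -/
def HasLqSpectrum (ν : Measure ℝ) (q τ : ℝ) : Prop :=
  Tendsto (fun δ : ℝ => Real.log (momentSum ν q δ) / (-Real.log δ)) (𝓝[>] 0) (𝓝 τ)

section BoxDimension

variable {X : Type*} [PseudoEMetricSpace X]

/-- `N_δ(A)`: the least number of sets of diameter at most `δ` that cover `A`. -/
noncomputable def coverCount (A : Set X) (δ : ℝ) : ℕ :=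
  sInf {n : ℕ | ∃ U : Fin n → Set X,
    (∀ j, Metric.ediam (U j) ≤ ENNReal.ofReal δ) ∧ A ⊆ ⋃ j, U j}

/-- The upper box dimension of a (bounded, non-empty) set. -/
noncomputable def upperBoxDim (A : Set X) : EReal :=
  limsup (fun δ : ℝ => ((Real.log (coverCount A δ) / (-Real.log δ) : ℝ) : EReal)) (𝓝[>] 0)

/-- The lower box dimension of a (bounded, non-empty) set. -/
noncomputable def lowerBoxDim (A : Set X) : EReal :=
  liminf (fun δ : ℝ => ((Real.log (coverCount A δ) / (-Real.log δ) : ℝ) : EReal)) (𝓝[>] 0)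

/-- The box dimension of `A` exists and equals `d`. -/
def HasBoxDim (A : Set X) (d : ℝ) : Prop :=
  upperBoxDim A = (d : EReal) ∧ lowerBoxDim A = (d : EReal)

end BoxDimension

/-! Write W = `S.width w` and H = `S.height w` for the diagonal entries of the lower triangular
Jacobian of S_w at the origin. Hölder derivatives give bounded distortion, and domination gives H ≤
W and a shear entry of size O(W) (`LetterBounds.exists_wordBounds`). Up to constants, S_w F is thus
a thin sheared strip of height at most H whose projection is a copy of πF scaled by W. At a scale δ
comparable to H the height is invisible, and S_w F needs about N(πF, δ/W) ≈ (W/δ)^β ≈ δ^(-s) W^β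
H^(s-β) covering sets. The singular values are comparable to W and H (`alpha_bounds`), so this
weight is the singular value function at q = 0 up to constants.

The exponent β exists because N(πF, ·) is supermultiplicative up to a constant: each mesh interval
meeting πF lies near a scaled copy of πF (`exists_supermul`). Every cylinder has positive measure,
so the moment sum at q = 0 counts mesh intervals that meet πF and is comparable to N(πF, δ)
(`momentSum_zero_bounds`).

Distortion makes the level sums of the weights almost multiplicative. The limit L(s) of (1/k) log
`levelSum` therefore exists, and since d^k ≤ H ≤ c^k for words of length k, L decreases with slopes
between log d and log c. It has a single zero γ (`exists_pressure`).

If t > γ, the weights of all words have a finite sum; covering F by cylinders of height about δ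
gives the upper bound (`upperBoxDim_le`). If t < γ, replacing a word by all its extensions of a
fixed length does not lower the total weight, so there are incomparable words of height about δ with
total weight at least 1 (`exists_antichain`). Under the rectangular open set condition a set of
diameter δ meets boundedly many of their cylinders (`exists_overlap_bound`), so their covering
numbers add up to the lower bound (`le_lowerBoxDim`). -/

/-! ### Covering numbers. -/

section Covers

variable {X Y Z : Type*}

/-- `A` can be covered by `n` sets of diameter at most `δ`. -/
def HasCover [PseudoEMetricSpace X] (A : Set X) (δ : ℝ) (n : ℕ) : Prop :=
  ∃ U : Fin n → Set X, (∀ j, Metric.ediam (U j) ≤ ENNReal.ofReal δ) ∧ A ⊆ ⋃ j, U j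

theorem hasCover_of_fintype [PseudoEMetricSpace X] {ι : Type*} [Fintype ι] {A : Set X} {δ : ℝ}
    (U : ι → Set X) (hU : ∀ j, Metric.ediam (U j) ≤ ENNReal.ofReal δ) (hA : A ⊆ ⋃ j, U j) :
    HasCover A δ (Fintype.card ι) := by
  refine ⟨fun j => U ((Fintype.equivFin ι).symm j), fun j => hU _, fun x hx => ?_⟩
  obtain ⟨i, hi⟩ := mem_iUnion.1 (hA hx)
  exact mem_iUnion.2 ⟨Fintype.equivFin ι i, by simpa using hi⟩

theorem coverCount_le_of_hasCover [PseudoEMetricSpace X] {A : Set X} {δ : ℝ} {n : ℕ}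
    (h : HasCover A δ n) : coverCount A δ ≤ n :=
  Nat.sInf_le h

variable [PseudoMetricSpace X] [PseudoMetricSpace Y]

theorem TotallyBounded.hasCover_coverCount {A : Set X} (hA : TotallyBounded A) {δ : ℝ}
    (hδ : 0 < δ) : HasCover A δ (coverCount A δ) := by
  refine Nat.sInf_mem (s := {n | HasCover A δ n}) ?_
  obtain ⟨t, ht, hAt⟩ := Metric.totallyBounded_iff.1 hA (δ / 2) (by positivity)
  have := ht.fintype
  refine ⟨_, hasCover_of_fintype (fun y : t => Metric.ball (y : X) (δ / 2)) (fun j => ?_) ?_⟩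
  · refine Metric.ediam_le fun x hx y hy => ?_
    rw [edist_dist]
    refine ENNReal.ofReal_le_ofReal ?_
    have h1 := dist_triangle_right x y j
    have h2 := Metric.mem_ball.1 hx
    have h3 := Metric.mem_ball.1 hy
    linarith
  · simpa [iUnion_subtype] using hAt

theorem dist_le_of_ediam_le {U : Set X} {δ : ℝ} (hδ : 0 ≤ δ)
    (hU : Metric.ediam U ≤ ENNReal.ofReal δ) {x y : X} (hx : x ∈ U) (hy : y ∈ U) :
    dist x y ≤ δ := by
  have := (Metric.edist_le_ediam_of_mem hx hy).trans hU
  rwa [edist_dist, ENNReal.ofReal_le_ofReal_iff hδ] at this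

/-- A cover of `φ '' A` is pulled back to `A` and pushed forward by `ψ`. Comparing two images of one
set avoids constructing a Lipschitz map between them. -/
theorem coverCount_image_le {A : Set Z} (φ : Z → X) (ψ : Z → Y) {r δ : ℝ} (hr : 0 < r)
    (hA : TotallyBounded (φ '' A))
    (h : ∀ a ∈ A, ∀ b ∈ A, dist (φ a) (φ b) ≤ r → dist (ψ a) (ψ b) ≤ δ) :
    coverCount (ψ '' A) δ ≤ coverCount (φ '' A) r := by
  obtain ⟨U, hU, hAU⟩ := hA.hasCover_coverCount hr
  refine coverCount_le_of_hasCover ⟨fun j => ψ '' (A ∩ φ ⁻¹' U j), fun j => ?_, ?_⟩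
  · refine Metric.ediam_le ?_
    rintro _ ⟨a, ⟨ha, haU⟩, rfl⟩ _ ⟨b, ⟨hb, hbU⟩, rfl⟩
    rw [edist_dist]
    exact ENNReal.ofReal_le_ofReal (h a ha b hb (dist_le_of_ediam_le hr.le (hU j) haU hbU))
  · rintro _ ⟨a, ha, rfl⟩
    obtain ⟨j, hj⟩ := mem_iUnion.1 (hAU (mem_image_of_mem φ ha))
    exact mem_iUnion.2 ⟨j, a, ⟨ha, hj⟩, rfl⟩

theorem coverCount_anti {A : Set X} (hA : TotallyBounded A) {r δ : ℝ} (hr : 0 < r) (h : r ≤ δ) :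
    coverCount A δ ≤ coverCount A r := by
  simpa using coverCount_image_le (A := A) id id hr (by simpa using hA)
    (fun a _ b _ hab => hab.trans h)

theorem one_le_coverCount {A : Set X} (hA : TotallyBounded A) (hne : A.Nonempty) {δ : ℝ}
    (hδ : 0 < δ) : 1 ≤ coverCount A δ := by
  obtain ⟨U, -, hAU⟩ := hA.hasCover_coverCount hδ
  obtain ⟨x, hx⟩ := hne
  obtain ⟨j, -⟩ := mem_iUnion.1 (hAU hx)
  exact Nat.one_le_iff_ne_zero.2 (fun h => (Fin.cast h j).elim0)

theorem coverCount_le_sum {ι : Type*} {A : Set X} (T : Finset ι) (B : ι → Set X)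
    (hB : ∀ i ∈ T, TotallyBounded (B i)) (hA : A ⊆ ⋃ i ∈ T, B i) {δ : ℝ} (hδ : 0 < δ) :
    coverCount A δ ≤ ∑ i ∈ T, coverCount (B i) δ := by
  choose U hU hBU using fun i : T => (hB i i.2).hasCover_coverCount hδ
  have := hasCover_of_fintype (A := A) (δ := δ)
    (fun p : Σ i : T, Fin (coverCount (B i) δ) => U p.1 p.2) (fun p => hU _ _) (fun x hx => by
      obtain ⟨i, hi, hx⟩ := mem_iUnion₂.1 (hA hx)
      obtain ⟨j, hj⟩ := mem_iUnion.1 (hBU ⟨i, hi⟩ hx)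
      exact mem_iUnion.2 ⟨⟨⟨i, hi⟩, j⟩, hj⟩)
  refine (coverCount_le_of_hasCover this).trans_eq ?_
  rw [Fintype.card_sigma, ← Finset.sum_coe_sort T]
  simp

-- Double counting of the pairs (U_j, B_i) that meet: an optimal cover of `A` restricts to a cover
-- of each B_i, and each U_j serves at most `K` indices.
open Classical in
theorem sum_coverCount_le {ι : Type*} {A : Set X} (hA : TotallyBounded A) (T : Finset ι)
    (B : ι → Set X) (hB : ∀ i ∈ T, B i ⊆ A) {δ : ℝ} (hδ : 0 < δ) (K : ℕ)
    (hK : ∀ U : Set X, Metric.ediam U ≤ ENNReal.ofReal δ →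
      (T.filter fun i => (U ∩ B i).Nonempty).card ≤ K) :
    ∑ i ∈ T, coverCount (B i) δ ≤ K * coverCount A δ := by
  obtain ⟨U, hU, hAU⟩ := hA.hasCover_coverCount hδ
  have h1 : ∀ i ∈ T, coverCount (B i) δ ≤
      (Finset.univ.filter fun j => (U j ∩ B i).Nonempty).card := by
    intro i hi
    refine (coverCount_le_of_hasCover (hasCover_of_fintype
      (ι := ↥(Finset.univ.filter fun j => (U j ∩ B i).Nonempty))
      (fun j => U j) (fun j => hU j) fun x hx => ?_)).trans_eq (by convert Fintype.card_coe _)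
    obtain ⟨j, hj⟩ := mem_iUnion.1 (hAU (hB i hi hx))
    exact mem_iUnion.2 ⟨⟨j, by simpa using ⟨x, hj, hx⟩⟩, hj⟩
  calc ∑ i ∈ T, coverCount (B i) δ
      ≤ ∑ i ∈ T, (Finset.univ.filter fun j => (U j ∩ B i).Nonempty).card := Finset.sum_le_sum h1
    _ = ∑ j, (T.filter fun i => (U j ∩ B i).Nonempty).card :=
        Finset.sum_card_bipartiteAbove_eq_sum_card_bipartiteBelow fun i j => (U j ∩ B i).Nonempty
    _ ≤ ∑ _j : Fin (coverCount A δ), K := Finset.sum_le_sum fun j _ => hK _ (hU j)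
    _ = K * coverCount A δ := by simp [mul_comm]

/-- On the line, a nonempty set of diameter at most δ lies in the interval of length δ that starts
at its infimum; this interval is cut at its midpoint. -/
theorem coverCount_half_le {A : Set ℝ} (hA : TotallyBounded A) {δ : ℝ} (hδ : 0 < δ) :
    coverCount A (δ / 2) ≤ 2 * coverCount A δ := by
  obtain ⟨U, hU, hAU⟩ := hA.hasCover_coverCount hδ
  have := hasCover_of_fintype (A := A) (δ := δ / 2)
    (fun p : Fin 2 × Fin (coverCount A δ) => if p.1 = 0 then
      Icc (sInf (U p.2)) (sInf (U p.2) + δ / 2) else Icc (sInf (U p.2) + δ / 2) (sInf (U p.2) + δ))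
    (fun p => by
      split_ifs
      · rw [Real.ediam_Icc]; exact ENNReal.ofReal_le_ofReal (by linarith)
      · rw [Real.ediam_Icc]; exact ENNReal.ofReal_le_ofReal (by linarith))
    (fun x hx => by
      obtain ⟨j, hj⟩ := mem_iUnion.1 (hAU hx)
      have hd : ∀ y ∈ U j, |x - y| ≤ δ := fun y hy => dist_le_of_ediam_le hδ.le (hU j) hj hy
      have h1 : sInf (U j) ≤ x := csInf_le ⟨x - δ, fun y hy => by
        have := abs_le.1 (hd y hy); linarith⟩ hj
      have h2 : x - δ ≤ sInf (U j) := le_csInf ⟨x, hj⟩ fun y hy => by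
        have := abs_le.1 (hd y hy); linarith
      rcases le_total x (sInf (U j) + δ / 2) with h | h
      · exact mem_iUnion.2 ⟨(0, j), by simpa using ⟨h1, h⟩⟩
      · exact mem_iUnion.2 ⟨(1, j), by simpa using ⟨h, by linarith⟩⟩)
  simpa using coverCount_le_of_hasCover this

end Covers

/-! ### Box dimension and power bounds for covering numbers. -/

section Dimension

variable {X : Type*} [PseudoMetricSpace X]

theorem eventually_Ioo_nhdsGT {R : ℝ} (hR : 0 < R) : ∀ᶠ δ in 𝓝[>] (0 : ℝ), δ ∈ Ioo 0 R :=
  Ioo_mem_nhdsGT hR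

theorem tendsto_neg_log_nhdsGT : Tendsto (fun δ : ℝ => -Real.log δ) (𝓝[>] 0) atTop :=
  tendsto_neg_atBot_atTop.comp Real.tendsto_log_nhdsGT_zero

theorem tendsto_const_add_div_neg_log (K s : ℝ) :
    Tendsto (fun δ : ℝ => K / (-Real.log δ) + s) (𝓝[>] 0) (𝓝 s) := by
  simpa using (tendsto_const_nhds.div_atTop tendsto_neg_log_nhdsGT).add_const s

theorem log_const_mul_rpow_div {C s δ : ℝ} (hC : 0 < C) (h0 : 0 < δ) (h1 : δ < 1) :
    Real.log (C * δ ^ (-s)) / (-Real.log δ) = Real.log C / (-Real.log δ) + s := by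
  have : Real.log δ ≠ 0 := (Real.log_neg h0 h1).ne
  rw [Real.log_mul hC.ne' (by positivity), Real.log_rpow h0, add_div]
  congr 1
  field_simp

theorem upperBoxDim_le_of_coverCount_le {A : Set X} (hA : TotallyBounded A) (hne : A.Nonempty)
    {C s : ℝ} (hC : 0 < C)
    (h : ∀ᶠ δ in 𝓝[>] (0 : ℝ), (coverCount A δ : ℝ) ≤ C * δ ^ (-s)) :
    upperBoxDim A ≤ (s : EReal) := by
  have hlim : Tendsto (fun δ : ℝ => ((Real.log C / (-Real.log δ) + s : ℝ) : EReal)) (𝓝[>] 0)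
      (𝓝 (s : EReal)) :=
    (continuous_coe_real_ereal.tendsto s).comp (tendsto_const_add_div_neg_log (Real.log C) s)
  rw [← hlim.limsup_eq]
  refine limsup_le_limsup ?_
  filter_upwards [h, eventually_Ioo_nhdsGT one_pos] with δ hδ h01
  rw [EReal.coe_le_coe_iff, ← log_const_mul_rpow_div hC h01.1 h01.2]
  have := neg_pos.2 (Real.log_neg h01.1 h01.2)
  have h1 := one_le_coverCount hA hne h01.1
  have h2 : (0 : ℝ) < coverCount A δ := by exact_mod_cast h1
  gcongr

theorem le_lowerBoxDim_of_le_coverCount {A : Set X} {C s : ℝ} (hC : 0 < C)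
    (h : ∀ᶠ δ in 𝓝[>] (0 : ℝ), C * δ ^ (-s) ≤ (coverCount A δ : ℝ)) :
    (s : EReal) ≤ lowerBoxDim A := by
  have hlim : Tendsto (fun δ : ℝ => ((Real.log C / (-Real.log δ) + s : ℝ) : EReal)) (𝓝[>] 0)
      (𝓝 (s : EReal)) :=
    (continuous_coe_real_ereal.tendsto s).comp (tendsto_const_add_div_neg_log (Real.log C) s)
  rw [← hlim.liminf_eq]
  refine liminf_le_liminf ?_
  filter_upwards [h, eventually_Ioo_nhdsGT one_pos] with δ hδ h01
  rw [EReal.coe_le_coe_iff, ← log_const_mul_rpow_div hC h01.1 h01.2]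
  have := neg_pos.2 (Real.log_neg h01.1 h01.2)
  have := h01.1
  gcongr

theorem hasBoxDim_of_tendsto {A : Set X} {s : ℝ}
    (h : Tendsto (fun δ : ℝ => Real.log (coverCount A δ) / (-Real.log δ)) (𝓝[>] 0) (𝓝 s)) :
    HasBoxDim A s := by
  have := (continuous_coe_real_ereal.tendsto s).comp h
  exact ⟨this.limsup_eq, this.liminf_eq⟩

theorem lowerBoxDim_le_upperBoxDim (A : Set X) : lowerBoxDim A ≤ upperBoxDim A :=
  liminf_le_limsup

/-- The bound is needed up to an arbitrary `R` because it is applied at radii of order δ/W, which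
need not be small. The limit controls small radii; on the remaining compact range the count is
bounded by monotonicity and r^t by continuity. -/
theorem exists_coverCount_le_of_tendsto {A : Set X} (hA : TotallyBounded A) (hne : A.Nonempty)
    {s : ℝ} (h : Tendsto (fun δ : ℝ => Real.log (coverCount A δ) / (-Real.log δ)) (𝓝[>] 0) (𝓝 s))
    {t : ℝ} (ht : s < t) (R : ℝ) :
    ∃ C > 0, ∀ r ∈ Ioc 0 R, (coverCount A r : ℝ) ≤ C * r ^ (-t) := by
  have h1 := (h.eventually (gt_mem_nhds ht)).and (eventually_Ioo_nhdsGT one_pos)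
  obtain ⟨r₀, hr₀, h2⟩ := (mem_nhdsGT_iff_exists_Ioo_subset).1 h1
  have hr₀' : 0 < r₀ := hr₀
  set N : ℝ := ((coverCount A (r₀ / 2) : ℕ) : ℝ) with hN
  have hN0 : 0 < N := by
    have := one_le_coverCount hA hne (half_pos hr₀'); rw [hN]; exact_mod_cast this
  obtain ⟨M, hM⟩ := (isCompact_Icc (a := r₀ / 2) (b := R)).bddAbove_image
    (f := fun r : ℝ => r ^ t) (ContinuousOn.rpow_const continuousOn_id fun x hx => Or.inl
      ((half_pos hr₀').trans_le hx.1).ne')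
  refine ⟨max 1 (N * M), by positivity, fun r hr => ?_⟩
  have hr0 := hr.1
  rcases lt_or_ge r (r₀ / 2) with hlt | hge
  · have h3 : r ∈ Ioo 0 r₀ := ⟨hr.1, by linarith⟩
    obtain ⟨h4, h5⟩ := h2 h3
    have hN1 : (0 : ℝ) < coverCount A r := by exact_mod_cast one_le_coverCount hA hne hr.1
    have h6 : 0 < -Real.log r := neg_pos.2 (Real.log_neg h5.1 h5.2)
    rw [div_lt_iff₀ h6] at h4
    have h7 : (coverCount A r : ℝ) ≤ r ^ (-t) := by
      rw [← Real.log_le_log_iff hN1 (by positivity), Real.log_rpow hr.1]; linarith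
    calc (coverCount A r : ℝ) ≤ 1 * r ^ (-t) := by simpa using h7
      _ ≤ _ := by gcongr; exact le_max_left _ _
  · have h3 : (coverCount A r : ℝ) ≤ N := by
      rw [hN]; exact_mod_cast coverCount_anti hA (half_pos hr₀') hge
    have h4 : r ^ t ≤ M := hM ⟨r, ⟨hge, hr.2⟩, rfl⟩
    calc (coverCount A r : ℝ) ≤ N := h3
      _ = N * r ^ t * r ^ (-t) := by rw [mul_assoc, ← Real.rpow_add hr.1]; simp
      _ ≤ max 1 (N * M) * r ^ (-t) := by
        gcongr
        exact (mul_le_mul_of_nonneg_left h4 hN0.le).trans (le_max_right _ _)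

theorem exists_le_coverCount_of_tendsto {A : Set X} (hA : TotallyBounded A) (hne : A.Nonempty)
    {s : ℝ} (h : Tendsto (fun δ : ℝ => Real.log (coverCount A δ) / (-Real.log δ)) (𝓝[>] 0) (𝓝 s))
    {t : ℝ} (ht : t < s) (R : ℝ) :
    ∃ C > 0, ∀ r ∈ Ioc 0 R, C * r ^ (-t) ≤ (coverCount A r : ℝ) := by
  have h1 := (h.eventually (lt_mem_nhds ht)).and (eventually_Ioo_nhdsGT one_pos)
  obtain ⟨r₀, hr₀, h2⟩ := (mem_nhdsGT_iff_exists_Ioo_subset).1 h1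
  have hr₀' : 0 < r₀ := hr₀
  obtain ⟨M, hM⟩ := (isCompact_Icc (a := r₀ / 2) (b := R)).bddAbove_image
    (f := fun r : ℝ => r ^ (-t)) (ContinuousOn.rpow_const continuousOn_id fun x hx => Or.inl
      ((half_pos hr₀').trans_le hx.1).ne')
  refine ⟨(max 1 M)⁻¹, by positivity, fun r hr => ?_⟩
  have hr0 := hr.1
  have hN1 : (1 : ℝ) ≤ coverCount A r := by exact_mod_cast one_le_coverCount hA hne hr.1
  rw [inv_mul_le_iff₀ (by positivity)]
  rcases lt_or_ge r (r₀ / 2) with hlt | hge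
  · have h3 : r ∈ Ioo 0 r₀ := ⟨hr.1, by linarith⟩
    obtain ⟨h4, h5⟩ := h2 h3
    have h6 : 0 < -Real.log r := neg_pos.2 (Real.log_neg h5.1 h5.2)
    rw [lt_div_iff₀ h6] at h4
    have h7 : r ^ (-t) ≤ (coverCount A r : ℝ) := by
      rw [← Real.log_le_log_iff (by positivity) (by linarith), Real.log_rpow hr.1]; linarith
    nlinarith [le_max_left 1 M]
  · have h4 : r ^ (-t) ≤ M := hM ⟨r, ⟨hge, hr.2⟩, rfl⟩
    have := le_max_right 1 M
    have := le_max_left 1 M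
    nlinarith

end Dimension

/-! ### Existence of limits from almost superadditivity. -/

section RealLimit

/-- Fekete's lemma for `K - a n`; the linear upper bound on `a` keeps its quotients bounded below.
-/
theorem tendsto_div_of_subadditive_of_le {a : ℕ → ℝ} {K M : ℝ}
    (hsub : ∀ m n, a m + a n ≤ a (m + n) + K) (hle : ∀ n, a n ≤ M * n + M) :
    ∃ L, Tendsto (fun n : ℕ => a n / n) atTop (𝓝 L) := by
  have hu : Subadditive fun n => -a n + K := fun m n => by have := hsub m n; dsimp only; linarith
  have hb : BddBelow (range fun n : ℕ => (-a n + K) / n) := by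
    refine ⟨-(|M| + |M| + |K|), ?_⟩
    rintro _ ⟨n, rfl⟩
    rcases Nat.eq_zero_or_pos n with rfl | hn
    · have h3 := abs_nonneg M
      have h4 := abs_nonneg K
      simp only [Nat.cast_zero, div_zero]
      linarith
    · have hn' : (1 : ℝ) ≤ n := by exact_mod_cast hn
      dsimp only
      rw [le_div_iff₀ (by linarith)]
      have := hle n
      have h1 := le_abs_self M
      have h2 := neg_abs_le K
      have h3 := abs_nonneg M
      have h4 := abs_nonneg K
      nlinarith
  have h := (hu.tendsto_lim hb).neg.add
    ((tendsto_const_nhds (x := K)).div_atTop tendsto_natCast_atTop_atTop)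
  exact ⟨_, h.congr fun n => by ring⟩

/-- Along the scales 2^(-n) the limit comes from superadditivity. Halving the scale at most doubles
the count, which supplies both the linear growth bound and the passage to general δ. -/
theorem exists_tendsto_of_coverCount_supermul {A : Set ℝ} (hA : TotallyBounded A)
    (hne : A.Nonempty) {c : ℝ} (hc : 0 < c)
    (h : ∀ δ ∈ Ioc (0 : ℝ) 1, ∀ r ∈ Ioc (0 : ℝ) 1,
      c * (coverCount A δ * coverCount A r) ≤ (coverCount A (δ * r) : ℝ)) :
    ∃ s, Tendsto (fun δ : ℝ => Real.log (coverCount A δ) / (-Real.log δ)) (𝓝[>] 0) (𝓝 s) := by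
  have hpos : ∀ δ : ℝ, 0 < δ → (0 : ℝ) < coverCount A δ := fun δ hδ => by
    exact_mod_cast one_le_coverCount hA hne hδ
  set a : ℕ → ℝ := fun n => Real.log (coverCount A ((1 / 2 : ℝ) ^ n)) with ha
  have hstep : ∀ n, a (n + 1) ≤ a n + Real.log 2 := fun n => by
    have h1 : (0 : ℝ) < (1 / 2 : ℝ) ^ n := by positivity
    have h2 : (coverCount A ((1 / 2 : ℝ) ^ n / 2) : ℝ) ≤ 2 * coverCount A ((1 / 2 : ℝ) ^ n) := by
      exact_mod_cast coverCount_half_le hA h1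
    have h3 := hpos _ h1
    rw [ha]
    dsimp only
    rw [add_comm (Real.log _), ← Real.log_mul (by norm_num) h3.ne']
    refine Real.log_le_log (hpos _ (by positivity)) ?_
    rwa [pow_succ, mul_one_div]
  have hsub : ∀ m n, a m + a n ≤ a (m + n) + (-Real.log c) := fun m n => by
    have h1 : (0 : ℝ) < (1 / 2 : ℝ) ^ m := by positivity
    have h2 : (0 : ℝ) < (1 / 2 : ℝ) ^ n := by positivity
    have := h _ ⟨h1, pow_le_one₀ (by norm_num) (by norm_num)⟩ _
      ⟨h2, pow_le_one₀ (by norm_num) (by norm_num)⟩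
    rw [← pow_add] at this
    have h3 := hpos _ h1
    have h4 := hpos _ h2
    have h5 := Real.log_le_log (by positivity) this
    rw [Real.log_mul hc.ne' (by positivity), Real.log_mul h3.ne' h4.ne'] at h5
    simp only [ha]
    linarith
  have hle : ∀ n, a n ≤ Real.log 2 * n + a 0 := fun n => by
    induction n with
    | zero => simp
    | succ n ih => push_cast; linarith [hstep n]
  obtain ⟨L, hL⟩ := tendsto_div_of_subadditive_of_le (M := max (Real.log 2) (a 0)) hsub fun n => by
    refine (hle n).trans ?_
    gcongr
    · exact le_max_left _ _
    · exact le_max_right _ _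
  have hl2 : 0 < Real.log 2 := Real.log_pos (by norm_num)
  have hx : Tendsto (fun δ : ℝ => -Real.log δ / Real.log 2) (𝓝[>] 0) atTop :=
    tendsto_neg_log_nhdsGT.atTop_div_const hl2
  have h1 := hL.comp (tendsto_nat_floor_atTop.comp hx)
  have h2 := (tendsto_nat_floor_div_atTop (R := ℝ)).comp hx
  have h3 := ((h1.mul h2).div_const (Real.log 2))
  have h4 : Tendsto (fun δ : ℝ => Real.log 2 / (-Real.log δ)) (𝓝[>] 0) (𝓝 0) :=
    tendsto_const_nhds.div_atTop tendsto_neg_log_nhdsGT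
  refine ⟨L * 1 / Real.log 2, ?_⟩
  -- With n the integer part of -log δ / log 2, δ lies between 2^(-n-1) and 2^(-n), so the logarithm
  -- of the count is within log 2 of `a n`.
  have key : ∀ᶠ δ in 𝓝[>] (0 : ℝ), |Real.log (coverCount A δ) / (-Real.log δ) -
      a ⌊-Real.log δ / Real.log 2⌋₊ / ⌊-Real.log δ / Real.log 2⌋₊ *
      (⌊-Real.log δ / Real.log 2⌋₊ / (-Real.log δ / Real.log 2)) / Real.log 2| ≤
      Real.log 2 / (-Real.log δ) := by
    filter_upwards [eventually_Ioo_nhdsGT one_pos, hx.eventually_ge_atTop 1] with δ hδ hx1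
    set n := ⌊-Real.log δ / Real.log 2⌋₊ with hn
    have hn0 : 0 < n := Nat.floor_pos.2 hx1
    have hlog : 0 < -Real.log δ := neg_pos.2 (Real.log_neg hδ.1 hδ.2)
    have hn1 : (n : ℝ) ≤ -Real.log δ / Real.log 2 := Nat.floor_le (by positivity)
    have hn2 : -Real.log δ / Real.log 2 < n + 1 := Nat.lt_floor_add_one _
    rw [le_div_iff₀ hl2] at hn1
    rw [div_lt_iff₀ hl2] at hn2
    have e : ∀ m : ℕ, Real.log ((1 / 2 : ℝ) ^ m) = -(m * Real.log 2) := fun m => by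
      rw [Real.log_pow]; simp
    have hb1 : δ ≤ (1 / 2 : ℝ) ^ n := by
      rw [← Real.log_le_log_iff hδ.1 (by positivity), e]; linarith
    have hb2 : (1 / 2 : ℝ) ^ (n + 1) ≤ δ := by
      rw [← Real.log_le_log_iff (by positivity) hδ.1, e]; push_cast; linarith
    have hc1 : a n ≤ Real.log (coverCount A δ) :=
      Real.log_le_log (hpos _ (by positivity)) (by exact_mod_cast coverCount_anti hA hδ.1 hb1)
    have hc2 : Real.log (coverCount A δ) ≤ a n + Real.log 2 :=
      (Real.log_le_log (hpos _ hδ.1)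
        (by exact_mod_cast coverCount_anti hA (by positivity) hb2)).trans (hstep n)
    have hn0' : (n : ℝ) ≠ 0 := by exact_mod_cast hn0.ne'
    have : a n / n * (n / (-Real.log δ / Real.log 2)) / Real.log 2 = a n / (-Real.log δ) := by
      field_simp
    rw [this, ← sub_div, abs_div, abs_of_pos hlog]
    gcongr
    rw [abs_le]
    constructor <;> linarith
  simp_rw [← Real.norm_eq_abs] at key
  have h5 := squeeze_zero_norm' key h4
  simpa using h5.add h3

end RealLimit
-- Singular values of triangular maps and the geometry of the square.
-- The eigenvalues of the adjoint of `T` composed with `T` are the squared singular values; their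
-- sum and product are its trace and determinant.
theorem singularValues_plane (T : Plane →ₗ[ℝ] Plane) {F C G : ℝ}
    (h0 : ∀ v, T v 0 = F * v 0) (h1 : ∀ v, T v 1 = C * v 0 + G * v 1) :
    T.singularValues 0 ^ 2 + T.singularValues 1 ^ 2 = F ^ 2 + C ^ 2 + G ^ 2 ∧
      T.singularValues 0 * T.singularValues 1 = |F * G| := by
  have hn : Module.finrank ℝ Plane = 2 := by simp
  set A := LinearMap.adjoint T ∘ₗ T with hA
  have hs : A.IsSymmetric := T.isSymmetric_adjoint_comp_self
  have e0 : T.singularValues 0 ^ 2 = hs.eigenvalues hn 0 := T.sq_singularValues_fin hn 0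
  have e1 : T.singularValues 1 ^ 2 = hs.eigenvalues hn 1 := T.sq_singularValues_fin hn 1
  set b := EuclideanSpace.basisFun (Fin 2) ℝ
  have hin : ∀ i j, inner ℝ (b i) (A (b j)) = inner ℝ (T (b i)) (T (b j)) := fun i j => by
    rw [hA, LinearMap.comp_apply, LinearMap.adjoint_inner_right]
  have hT : ∀ i j, inner ℝ (T (b i)) (T (b j)) = F * b i 0 * (F * b j 0) +
      (C * b i 0 + G * b i 1) * (C * b j 0 + G * b j 1) := fun i j => by
    simp [PiLp.inner_apply, Fin.sum_univ_two, h0, h1, mul_comm]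
  have ht := hs.re_trace_eq_sum_eigenvalues hn
  have hd := hs.det_eq_prod_eigenvalues hn
  rw [LinearMap.trace_eq_sum_inner _ b] at ht
  rw [← LinearMap.det_toMatrix b.toBasis, Matrix.det_fin_two] at hd
  simp only [LinearMap.toMatrix_apply, OrthonormalBasis.coe_toBasis,
    OrthonormalBasis.coe_toBasis_repr_apply, OrthonormalBasis.repr_apply_apply, hin, hT] at hd ht
  simp [Fin.sum_univ_two, Fin.prod_univ_two, b, ← e0, ← e1] at hd ht
  refine ⟨by linarith, ?_⟩
  rw [← abs_of_nonneg (mul_nonneg (T.singularValues_nonneg 0) (T.singularValues_nonneg 1)),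
    ← sq_eq_sq_iff_abs_eq_abs]
  linarith

section PlaneGeometry

theorem Plane.ext_coord {a b : Plane} (h0 : a 0 = b 0) (h1 : a 1 = b 1) : a = b := by
  ext j
  fin_cases j
  · exact h0
  · exact h1

theorem mem_unitSquare {a : Plane} : a ∈ unitSquare ↔ a 0 ∈ Icc (0 : ℝ) 1 ∧ a 1 ∈ Icc (0 : ℝ) 1 :=
  Fin.forall_fin_two

theorem mem_openUnitSquare {a : Plane} :
    a ∈ openUnitSquare ↔ a 0 ∈ Ioo (0 : ℝ) 1 ∧ a 1 ∈ Ioo (0 : ℝ) 1 :=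
  Fin.forall_fin_two

theorem openUnitSquare_subset : openUnitSquare ⊆ unitSquare := fun _ ha j =>
  Ioo_subset_Icc_self (ha j)

theorem vec_mem_unitSquare {x y : ℝ} (hx : x ∈ Icc (0 : ℝ) 1) (hy : y ∈ Icc (0 : ℝ) 1) :
    (!₂[x, y] : Plane) ∈ unitSquare :=
  mem_unitSquare.2 ⟨hx, hy⟩

theorem vec_mem_openUnitSquare {x y : ℝ} (hx : x ∈ Ioo (0 : ℝ) 1) (hy : y ∈ Ioo (0 : ℝ) 1) :
    (!₂[x, y] : Plane) ∈ openUnitSquare :=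
  mem_openUnitSquare.2 ⟨hx, hy⟩

theorem zero_mem_unitSquare : (0 : Plane) ∈ unitSquare := fun j => by simp

theorem unitSquare_eq_preimage :
    unitSquare = EuclideanSpace.equiv (Fin 2) ℝ ⁻¹' (univ.pi fun _ => Icc 0 1) := by
  ext a; simp [unitSquare, Pi.le_def, forall_and]

theorem openUnitSquare_eq_preimage :
    openUnitSquare = EuclideanSpace.equiv (Fin 2) ℝ ⁻¹' (univ.pi fun _ => Ioo 0 1) := by
  ext a; simp [openUnitSquare]

theorem isCompact_unitSquare : IsCompact unitSquare := by
  rw [unitSquare_eq_preimage]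
  exact (EuclideanSpace.equiv (Fin 2) ℝ).toHomeomorph.isCompact_preimage.2
    (isCompact_univ_pi fun _ => isCompact_Icc)

theorem isOpen_openUnitSquare : IsOpen openUnitSquare := by
  rw [openUnitSquare_eq_preimage]
  exact (isOpen_set_pi finite_univ fun _ _ => isOpen_Ioo).preimage
    (EuclideanSpace.equiv (Fin 2) ℝ).continuous

theorem convex_unitSquare : Convex ℝ unitSquare := fun a ha b hb s t hs ht hst j => by
  simpa using (convex_Icc (0 : ℝ) 1) (ha j) (hb j) hs ht hst

theorem uniqueDiffOn_unitSquare : UniqueDiffOn ℝ unitSquare :=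
  uniqueDiffOn_convex convex_unitSquare ⟨!₂[1 / 2, 1 / 2],
    interior_mono openUnitSquare_subset (by
      rw [isOpen_openUnitSquare.interior_eq]
      exact vec_mem_openUnitSquare (by norm_num) (by norm_num))⟩

theorem abs_sub_le_dist (a b : Plane) (j : Fin 2) : |a j - b j| ≤ dist a b := by
  rw [dist_eq_norm, ← Real.norm_eq_abs]
  exact PiLp.norm_apply_le (a - b) j

theorem dist_le_abs_add_abs (a b : Plane) : dist a b ≤ |a 0 - b 0| + |a 1 - b 1| := by
  refine abs_le_of_sq_le_sq' ?_ (by positivity) |>.2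
  rw [EuclideanSpace.dist_sq_eq, Fin.sum_univ_two, Real.dist_eq, Real.dist_eq]
  nlinarith [abs_nonneg (a 0 - b 0), abs_nonneg (a 1 - b 1)]

theorem dist_le_two_of_mem_unitSquare {a b : Plane} (ha : a ∈ unitSquare) (hb : b ∈ unitSquare) :
    dist a b ≤ 2 := by
  have h : ∀ j, |a j - b j| ≤ 1 := fun j => by
    have h1 := ha j
    have h2 := hb j
    exact abs_le.2 ⟨by linarith [h1.1, h2.2], by linarith [h1.2, h2.1]⟩
  linarith [dist_le_abs_add_abs a b, h 0, h 1]

end PlaneGeometry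

/-! ### Uniform bounds for the individual maps. -/

theorem Finite.exists_common_bound_lt {I : Type*} [Finite I] (u : I → ℝ) {M : ℝ}
    (h : ∀ i, u i < M) : ∃ c < M, ∀ i, u i ≤ c := by
  rcases isEmpty_or_nonempty I with hI | hI
  · exact ⟨M - 1, by linarith, fun i => hI.elim i⟩
  · obtain ⟨i, hi⟩ := Finite.exists_max u
    exact ⟨u i, h i, hi⟩

namespace NonlinearIFS

variable {I : Type*} (S : NonlinearIFS I)

/-- The partial derivative `g_{i,x}`. -/
noncomputable def gx (i : I) (a : Plane) : ℝ :=
  fderivWithin ℝ (S.g i) unitSquare a (EuclideanSpace.single 0 1)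

/-- Uniform bounds for the partial derivatives of the maps of the system. -/
structure LetterBounds (d c ρ M B θ : ℝ) : Prop where
  d_pos : 0 < d
  c_lt_one : c < 1
  ρ_lt_one : ρ < 1
  θ_pos : 0 < θ
  B_nonneg : 0 ≤ B
  le_gy : ∀ i, ∀ a ∈ unitSquare, d ≤ S.gy i a
  le_fx : ∀ i, ∀ a ∈ unitSquare, d ≤ S.fx i a
  gy_le : ∀ i, ∀ a ∈ unitSquare, S.gy i a ≤ ρ * S.fx i a
  fx_le : ∀ i, ∀ a ∈ unitSquare, S.fx i a ≤ c
  abs_gx_le : ∀ i, ∀ a ∈ unitSquare, |S.gx i a| ≤ M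
  dist_map_le : ∀ i, ∀ a ∈ unitSquare, ∀ b ∈ unitSquare, dist (S.map i a) (S.map i b) ≤ c * dist a b
  fx_holder : ∀ i, ∀ a ∈ unitSquare, ∀ b ∈ unitSquare, |S.fx i a - S.fx i b| ≤ B * dist a b ^ θ
  gy_holder : ∀ i, ∀ a ∈ unitSquare, ∀ b ∈ unitSquare, |S.gy i a - S.gy i b| ≤ B * dist a b ^ θ

variable {S}

theorem map_apply_zero (i : I) (a : Plane) : S.map i a 0 = S.f i (a 0) := rfl

theorem map_mem {i : I} {a : Plane} (ha : a ∈ unitSquare) : S.map i a ∈ unitSquare :=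
  S.mapsTo i ha

theorem lipschitzOnWith_f {i : I} {c : ℝ≥0} (h : LipschitzOnWith c (S.map i) unitSquare) :
    LipschitzOnWith c (S.f i) (Icc 0 1) := by
  refine LipschitzOnWith.of_dist_le_mul fun x hx y hy => ?_
  have h0 : (0 : ℝ) ∈ Icc (0 : ℝ) 1 := by simp
  have := h.dist_le_mul _ (vec_mem_unitSquare hx h0) _ (vec_mem_unitSquare hy h0)
  refine ((abs_sub_le_dist _ _ 0).trans this).trans ?_
  gcongr
  refine (dist_le_abs_add_abs _ _).trans ?_
  simp [Real.dist_eq]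

theorem abs_derivWithin_le_of_lipschitzOnWith {f : ℝ → ℝ} {c : ℝ≥0}
    (h : LipschitzOnWith c f (Icc 0 1)) (hf : DifferentiableOn ℝ f (Icc 0 1)) {x : ℝ}
    (hx : x ∈ Icc (0 : ℝ) 1) : |derivWithin f (Icc 0 1) x| ≤ c := by
  have hd := (hf x hx).hasDerivWithinAt
  rw [hasDerivWithinAt_iff_tendsto_slope] at hd
  have : (𝓝[Icc 0 1 \ {x}] x).NeBot :=
    accPt_principal_iff_nhdsWithin.1 ((uniqueDiffOn_Icc one_pos x hx).accPt)
  refine le_of_tendsto hd.abs ?_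
  filter_upwards [self_mem_nhdsWithin] with y hy
  have h1 := h.dist_le_mul y hy.1 x hx
  have h2 : 0 < |y - x| := abs_pos.2 (sub_ne_zero.2 hy.2)
  rw [slope_def_field, abs_div, div_le_iff₀ h2]
  simpa [Real.dist_eq] using h1

/-- Hölder derivatives are continuous on the compact square, so the real infima and suprema in the
domination condition bound the derivatives pointwise. Finiteness of `I` makes all constants uniform.
-/
theorem Dominated.exists_letterBounds [Finite I] (hS : S.Dominated) :
    ∃ d c ρ M B θ : ℝ, S.LetterBounds d c ρ M B θ := by
  obtain ⟨d, hd, hdom⟩ := hS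
  obtain ⟨α, hα, -, hreg⟩ := S.regular
  have hα' : (0 : ℝ) < α := hα
  choose c' hc' hlip using S.contracting
  obtain ⟨c, hc, hcc⟩ := Finite.exists_common_bound_lt (fun i => (c' i : ℝ)) (M := 1)
    (fun i => by exact_mod_cast hc' i)
  choose hfd Bf hBf using fun i => (hreg i).1
  choose hgd Bg hBg using fun i => (hreg i).2
  obtain ⟨B₁, hB₁⟩ := (Set.finite_range fun i => (Bf i : ℝ)).bddAbove
  obtain ⟨B₂, hB₂⟩ := (Set.finite_range fun i => (Bg i : ℝ)).bddAbove
  have h0 : ∀ a ∈ unitSquare, a 0 ∈ Icc (0 : ℝ) 1 := fun a ha => ha 0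
  have hfx : ∀ i, ∀ a ∈ unitSquare, ∀ b ∈ unitSquare,
      |S.fx i a - S.fx i b| ≤ Bf i * dist a b ^ (α : ℝ) := fun i a ha b hb => by
    simp only [fx, ← fderivWithin_derivWithin, ← sub_apply, ← Real.norm_eq_abs]
    refine ((ContinuousLinearMap.le_opNorm _ _).trans ?_)
    rw [norm_one, mul_one, ← dist_eq_norm]
    refine ((hBf i).dist_le (h0 a ha) (h0 b hb)).trans ?_
    gcongr
    exact abs_sub_le_dist a b 0
  have hv : ∀ j : Fin 2, ‖(EuclideanSpace.single j 1 : Plane)‖ = 1 := fun j => by simp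
  have hg : ∀ i, ∀ a ∈ unitSquare, ∀ b ∈ unitSquare, ∀ j : Fin 2,
      |fderivWithin ℝ (S.g i) unitSquare a (EuclideanSpace.single j 1) -
        fderivWithin ℝ (S.g i) unitSquare b (EuclideanSpace.single j 1)| ≤
        Bg i * dist a b ^ (α : ℝ) := fun i a ha b hb j => by
    rw [← sub_apply, ← Real.norm_eq_abs]
    refine ((ContinuousLinearMap.le_opNorm _ _).trans ?_)
    rw [hv, mul_one, ← dist_eq_norm]
    exact (hBg i).dist_le ha hb
  have hcf : ∀ i, ContinuousOn (S.fx i) unitSquare := fun i =>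
    HolderOnWith.continuousOn (C := Bf i) (r := α) (fun a ha b hb => by
      rw [edist_dist, edist_dist, Real.dist_eq, ENNReal.ofReal_rpow_of_nonneg dist_nonneg hα'.le,
        ← ENNReal.ofReal_coe_nnreal, ← ENNReal.ofReal_mul (by positivity)]
      exact ENNReal.ofReal_le_ofReal (hfx i a ha b hb)) hα
  have hcg : ∀ i j, ContinuousOn (fun a => fderivWithin ℝ (S.g i) unitSquare a
      (EuclideanSpace.single j 1)) unitSquare := fun i j =>
    ((hBg i).continuousOn hα).clm_apply continuousOn_const
  have hgyb : ∀ i, ∀ a ∈ unitSquare, sInf (S.gy i '' unitSquare) ≤ S.gy i a ∧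
      S.gy i a ≤ sSup (S.gy i '' unitSquare) := fun i a ha =>
    ⟨csInf_le (isCompact_unitSquare.bddBelow_image (hcg i 1)) (mem_image_of_mem _ ha),
      le_csSup (isCompact_unitSquare.bddAbove_image (hcg i 1)) (mem_image_of_mem _ ha)⟩
  have hfxb : ∀ i, ∀ a ∈ unitSquare, sInf (S.fx i '' unitSquare) ≤ S.fx i a := fun i a ha =>
    csInf_le (isCompact_unitSquare.bddBelow_image (hcf i)) (mem_image_of_mem _ ha)
  have hpos : ∀ i, 0 < sSup (S.gy i '' unitSquare) := fun i =>
    hd.trans_le ((hdom i).2.2.trans (hdom i).2.1)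
  -- The strict domination inequality becomes a uniform ratio: ρ bounds sup g_y / inf f_x over all
  -- letters.
  obtain ⟨ρ, hρ, hρ'⟩ := Finite.exists_common_bound_lt
    (fun i => sSup (S.gy i '' unitSquare) / sInf (S.fx i '' unitSquare)) (M := 1)
    (fun i => (div_lt_one ((hpos i).trans (hdom i).1)).2 (hdom i).1)
  choose M' hM' using fun i => isCompact_unitSquare.exists_bound_of_continuousOn (hcg i 0)
  obtain ⟨M, hM⟩ := (Set.finite_range M').bddAbove
  refine ⟨d, c, ρ, M, max 0 (max B₁ B₂), α, hd, hc, hρ, hα', le_max_left _ _,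
    fun i a ha => (hdom i).2.2.trans (hgyb i a ha).1,
    fun i a ha => ((hdom i).2.2.trans ((hdom i).2.1.trans (hdom i).1.le)).trans (hfxb i a ha),
    fun i a ha => ?_, fun i a ha => ?_,
    fun i a ha => (hM' i a ha).trans (hM ⟨i, rfl⟩), fun i a ha b hb => ?_,
    fun i a ha b hb => ?_, fun i a ha b hb => ?_⟩
  · have h1 : 0 < sInf (S.fx i '' unitSquare) := (hpos i).trans (hdom i).1
    have h2 := hρ' i
    have h3 : 0 ≤ ρ := (div_pos (hpos i) h1).le.trans h2
    rw [div_le_iff₀ h1] at h2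
    refine ((hgyb i a ha).2.trans h2).trans ?_
    gcongr
    exact hfxb i a ha
  · exact (le_abs_self _).trans ((abs_derivWithin_le_of_lipschitzOnWith
      (lipschitzOnWith_f (hlip i)) (hfd i) (ha 0)).trans (hcc i))
  · refine ((hlip i).dist_le_mul a ha b hb).trans ?_
    gcongr
    exact hcc i
  · refine (hfx i a ha b hb).trans ?_
    gcongr
    exact (hB₁ ⟨i, rfl⟩).trans ((le_max_left _ _).trans (le_max_right _ _))
  · refine (hg i a ha b hb 1).trans ?_
    gcongr
    exact (hB₂ ⟨i, rfl⟩).trans ((le_max_right _ _).trans (le_max_right _ _))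

end NonlinearIFS

/-! ### Derivatives along words and their distortion. -/

namespace NonlinearIFS

variable {I : Type*} (S : NonlinearIFS I)

/-- The composition `S_{i_1} ∘ ⋯ ∘ S_{i_k}` along a word given as a list. -/
def lmap : List I → Plane → Plane
  | [], a => a
  | i :: w, a => S.map i (lmap w a)

/-- The product of `φ` along the orbit of `a` under the word `w`. -/
def cocycle (φ : I → Plane → ℝ) : List I → Plane → ℝ
  | [], _ => 1
  | i :: w, a => φ i (S.lmap w a) * cocycle φ w a

/-- The lower left entry of the Jacobian of `S_w`. -/
noncomputable def shear : List I → Plane → ℝ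
  | [], _ => 0
  | i :: w, a => S.gx i (S.lmap w a) * S.cocycle S.fx w a + S.gy i (S.lmap w a) * shear w a

/-- The derivative of the first coordinate of `S_w` at the origin. -/
noncomputable def width (w : List I) : ℝ := S.cocycle S.fx w 0

/-- The vertical derivative of the second coordinate of `S_w` at the origin. -/
noncomputable def height (w : List I) : ℝ := S.cocycle S.gy w 0

variable {S}

theorem lmap_append (u v : List I) (a : Plane) : S.lmap (u ++ v) a = S.lmap u (S.lmap v a) := by
  induction u with
  | nil => rfl
  | cons i u ih => simp [lmap, ih]

theorem cocycle_append (φ : I → Plane → ℝ) (u v : List I) (a : Plane) :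
    S.cocycle φ (u ++ v) a = S.cocycle φ u (S.lmap v a) * S.cocycle φ v a := by
  induction u with
  | nil => simp [cocycle]
  | cons i u ih => simp [cocycle, ih, lmap_append, mul_assoc]

theorem lmap_mem (w : List I) {a : Plane} (ha : a ∈ unitSquare) : S.lmap w a ∈ unitSquare := by
  induction w with
  | nil => exact ha
  | cons i w ih => exact map_mem ih

theorem wordMap_eq_lmap : ∀ {k : ℕ} (w : Fin k → I), S.wordMap w = S.lmap (List.ofFn w)
  | 0, w => by funext a; simp [wordMap, lmap]
  | k + 1, w => by
    funext a
    rw [List.ofFn_succ]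
    simp only [wordMap, lmap, Function.comp_apply, wordMap_eq_lmap (Fin.tail w)]
    rfl

theorem pow_le_cocycle {φ : I → Plane → ℝ} {d : ℝ} (hd : 0 < d)
    (hφ : ∀ i, ∀ a ∈ unitSquare, d ≤ φ i a) (w : List I) {a : Plane} (ha : a ∈ unitSquare) :
    d ^ w.length ≤ S.cocycle φ w a := by
  induction w with
  | nil => simp [cocycle]
  | cons i w ih =>
    rw [List.length_cons, pow_succ', cocycle]
    have := hφ i _ (lmap_mem (S := S) w ha)
    exact mul_le_mul this ih (by positivity) (hd.le.trans this)

theorem cocycle_pos {φ : I → Plane → ℝ} {d : ℝ} (hd : 0 < d)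
    (hφ : ∀ i, ∀ a ∈ unitSquare, d ≤ φ i a) (w : List I) {a : Plane} (ha : a ∈ unitSquare) :
    0 < S.cocycle φ w a :=
  (pow_pos hd _).trans_le (pow_le_cocycle hd hφ w ha)

theorem cocycle_le_cocycle {φ ψ : I → Plane → ℝ} {d : ℝ} (hd : 0 < d)
    (hφ : ∀ i, ∀ a ∈ unitSquare, d ≤ φ i a) (h : ∀ i, ∀ a ∈ unitSquare, φ i a ≤ ψ i a)
    (w : List I) {a : Plane} (ha : a ∈ unitSquare) : S.cocycle φ w a ≤ S.cocycle ψ w a := by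
  induction w with
  | nil => simp [cocycle]
  | cons i w ih =>
    have h1 := h i _ (lmap_mem (S := S) w ha)
    have h2 := hφ i _ (lmap_mem (S := S) w ha)
    have h3 := cocycle_pos (S := S) hd hφ w ha
    exact mul_le_mul h1 ih h3.le (by linarith)

theorem cocycle_le_pow {φ : I → Plane → ℝ} {d c : ℝ} (hd : 0 < d)
    (hφ : ∀ i, ∀ a ∈ unitSquare, d ≤ φ i a) (hc : ∀ i, ∀ a ∈ unitSquare, φ i a ≤ c)
    (w : List I) {a : Plane} (ha : a ∈ unitSquare) : S.cocycle φ w a ≤ c ^ w.length := by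
  induction w with
  | nil => simp [cocycle]
  | cons i w ih =>
    have h1 := hc i _ (lmap_mem (S := S) w ha)
    have h2 := hφ i _ (lmap_mem (S := S) w ha)
    have h3 := cocycle_pos (S := S) hd hφ w ha
    rw [List.length_cons, pow_succ', cocycle]
    exact mul_le_mul h1 ih h3.le (by linarith)

namespace LetterBounds

variable {d c ρ M B θ : ℝ}

theorem c_nonneg (h : S.LetterBounds d c ρ M B θ) [Nonempty I] : 0 ≤ c :=
  (h.d_pos.le.trans (h.le_fx (Classical.arbitrary I) 0 zero_mem_unitSquare)).trans
    (h.fx_le _ 0 zero_mem_unitSquare)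

theorem gy_le_fx (h : S.LetterBounds d c ρ M B θ) (i : I) {a : Plane} (ha : a ∈ unitSquare) :
    S.gy i a ≤ S.fx i a := by
  have h1 := h.gy_le i a ha
  have h2 := h.le_fx i a ha
  have h3 := h.ρ_lt_one
  have h4 := h.d_pos
  nlinarith

theorem dist_lmap_le (h : S.LetterBounds d c ρ M B θ) [Nonempty I] (w : List I) {a b : Plane}
    (ha : a ∈ unitSquare) (hb : b ∈ unitSquare) :
    dist (S.lmap w a) (S.lmap w b) ≤ c ^ w.length * dist a b := by
  have hc := h.c_nonneg
  induction w with
  | nil => simp [lmap]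
  | cons i w ih =>
    refine (h.dist_map_le i _ (lmap_mem w ha) _ (lmap_mem w hb)).trans ?_
    rw [List.length_cons, pow_succ', mul_assoc]
    gcongr

/-- After applying `w`, two orbits are within 2c^|w|. Since φ ≥ d, the next letter changes the ratio
of the products by a factor of at most exp((B/d) 2^θ c^(θ|w|)), and these exponents form a geometric
series. -/
theorem cocycle_le_mul_cocycle (h : S.LetterBounds d c ρ M B θ) [Nonempty I]
    {φ : I → Plane → ℝ} (hφ : ∀ i, ∀ a ∈ unitSquare, d ≤ φ i a)
    (hφB : ∀ i, ∀ a ∈ unitSquare, ∀ b ∈ unitSquare, |φ i a - φ i b| ≤ B * dist a b ^ θ)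
    (w : List I) {a b : Plane} (ha : a ∈ unitSquare) (hb : b ∈ unitSquare) :
    S.cocycle φ w a ≤ Real.exp (B / d * 2 ^ θ * (1 - c ^ θ)⁻¹) * S.cocycle φ w b := by
  have hc := h.c_nonneg
  have hd := h.d_pos
  have hB := h.B_nonneg
  have hr0 : 0 ≤ c ^ θ := by positivity
  have hr1 : c ^ θ < 1 := Real.rpow_lt_one hc h.c_lt_one h.θ_pos
  have key : S.cocycle φ w a ≤
      Real.exp (B / d * 2 ^ θ * ∑ j ∈ Finset.range w.length, (c ^ θ) ^ j) * S.cocycle φ w b := by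
    induction w with
    | nil => simp [cocycle]
    | cons i w ih =>
      have hwa := lmap_mem (S := S) w ha
      have hwb := lmap_mem (S := S) w hb
      have h1 := abs_le.1 (hφB i _ hwa _ hwb)
      have h2 := hφ i _ hwb
      have h3 : dist (S.lmap w a) (S.lmap w b) ^ θ ≤ (c ^ θ) ^ w.length * 2 ^ θ := by
        rw [← Real.rpow_natCast, ← Real.rpow_mul hc, mul_comm θ, Real.rpow_mul hc,
          Real.rpow_natCast, ← Real.mul_rpow (by positivity) (by norm_num)]
        refine Real.rpow_le_rpow dist_nonneg ((h.dist_lmap_le w ha hb).trans ?_) h.θ_pos.le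
        gcongr
        exact dist_le_two_of_mem_unitSquare ha hb
      have h4 : φ i (S.lmap w a) ≤
          Real.exp (B / d * 2 ^ θ * (c ^ θ) ^ w.length) * φ i (S.lmap w b) := by
        have h5 := Real.add_one_le_exp (B / d * 2 ^ θ * (c ^ θ) ^ w.length)
        have h6 : B * dist (S.lmap w a) (S.lmap w b) ^ θ ≤
            B / d * 2 ^ θ * (c ^ θ) ^ w.length * φ i (S.lmap w b) := by
          calc B * dist (S.lmap w a) (S.lmap w b) ^ θ
              ≤ B * ((c ^ θ) ^ w.length * 2 ^ θ) := by gcongr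
            _ = B / d * 2 ^ θ * (c ^ θ) ^ w.length * d := by field_simp
            _ ≤ _ := by gcongr
        calc φ i (S.lmap w a)
            ≤ (B / d * 2 ^ θ * (c ^ θ) ^ w.length + 1) * φ i (S.lmap w b) := by linarith [h1.2]
          _ ≤ _ := by
            have : 0 ≤ φ i (S.lmap w b) := by linarith
            gcongr
      have h7 := cocycle_pos (S := S) hd hφ w ha
      have h8 := hφ i _ hwa
      rw [List.length_cons, Finset.sum_range_succ, mul_add, Real.exp_add, cocycle, cocycle]
      calc φ i (S.lmap w a) * S.cocycle φ w a ≤ _ :=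
            mul_le_mul h4 ih h7.le ((hd.le.trans h8).trans h4)
        _ = _ := by ring
  refine key.trans ?_
  have := cocycle_pos (S := S) hd hφ w hb
  have hs : ∑ j ∈ Finset.range w.length, (c ^ θ) ^ j ≤ (1 - c ^ θ)⁻¹ := by
    rw [← tsum_geometric_of_lt_one hr0 hr1]
    exact (summable_geometric_of_lt_one hr0 hr1).sum_le_tsum _ fun _ _ => by positivity
  gcongr

/-- Prepending a letter multiplies the old shear by g_y ≤ ρ f_x but the horizontal derivative by
f_x. The ratio of shear to horizontal derivative is thus contracted by ρ and gains at most |M|/d;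
the constant is the fixed point of x ↦ ρx + |M|/d. -/
theorem abs_shear_le (h : S.LetterBounds d c ρ M B θ) (w : List I) {a : Plane}
    (ha : a ∈ unitSquare) : |S.shear w a| ≤ |M| / (d * (1 - ρ)) * S.cocycle S.fx w a := by
  have hd := h.d_pos
  have hρ : 0 < 1 - ρ := sub_pos.2 h.ρ_lt_one
  induction w with
  | nil => simp [shear, cocycle]; positivity
  | cons i w ih =>
    have hwa := lmap_mem (S := S) w ha
    have hF := cocycle_pos (S := S) hd h.le_fx w ha
    have h1 := h.abs_gx_le i _ hwa
    have h2 := h.gy_le i _ hwa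
    have h3 := h.le_gy i _ hwa
    have h4 := h.le_fx i _ hwa
    set Q := |M| / (d * (1 - ρ)) with hQ
    have hQ0 : 0 ≤ Q := by positivity
    have hM : |M| ≤ (1 - ρ) * S.fx i (S.lmap w a) * Q := by
      calc |M| = (1 - ρ) * d * Q := by rw [hQ]; field_simp
        _ ≤ _ := by gcongr
    rw [shear, cocycle]
    calc |S.gx i (S.lmap w a) * S.cocycle S.fx w a + S.gy i (S.lmap w a) * S.shear w a|
        ≤ |S.gx i (S.lmap w a)| * S.cocycle S.fx w a + S.gy i (S.lmap w a) * |S.shear w a| := by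
          refine (abs_add_le _ _).trans_eq ?_
          rw [abs_mul, abs_mul, abs_of_pos hF, abs_of_pos (hd.trans_le h3)]
      _ ≤ |M| * S.cocycle S.fx w a +
          (ρ * S.fx i (S.lmap w a)) * (Q * S.cocycle S.fx w a) := by
          have : 0 ≤ ρ * S.fx i (S.lmap w a) := (hd.le.trans h3).trans h2
          have h5 := h1.trans (le_abs_self M)
          gcongr
      _ ≤ ((1 - ρ) * S.fx i (S.lmap w a) * Q) * S.cocycle S.fx w a +
          (ρ * S.fx i (S.lmap w a)) * (Q * S.cocycle S.fx w a) := by gcongr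
      _ = _ := by ring

end LetterBounds

theorem exists_hasFDerivWithinAt_map (i : I) {a : Plane} (ha : a ∈ unitSquare) :
    ∃ L : Plane →L[ℝ] Plane, HasFDerivWithinAt (S.map i) L unitSquare a ∧
      ∀ v, L v 0 = S.fx i a * v 0 ∧ L v 1 = S.gx i a * v 0 + S.gy i a * v 1 := by
  obtain ⟨α, -, -, hreg⟩ := S.regular
  have hf := ((hreg i).1.1 (a 0) (ha 0)).hasDerivWithinAt
  have hg := ((hreg i).2.1 a ha).hasFDerivWithinAt
  have hp : HasFDerivWithinAt (fun b : Plane => b 0) (EuclideanSpace.proj 0 : Plane →L[ℝ] ℝ)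
      unitSquare a := (EuclideanSpace.proj 0 : Plane →L[ℝ] ℝ).hasFDerivWithinAt
  have h0 := hf.comp_hasFDerivWithinAt a hp (fun b hb => hb 0)
  have hd : DifferentiableWithinAt ℝ (S.map i) unitSquare a :=
    differentiableWithinAt_euclidean.2 <| Fin.forall_fin_two.2
      ⟨h0.differentiableWithinAt, hg.differentiableWithinAt⟩
  have hL := hasFDerivWithinAt_euclidean.1 hd.hasFDerivWithinAt
  have e0 := (uniqueDiffOn_unitSquare a ha).eq (hL 0) h0
  have e1 := (uniqueDiffOn_unitSquare a ha).eq (hL 1) hg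
  refine ⟨_, hd.hasFDerivWithinAt, fun v => ⟨?_, ?_⟩⟩
  · simpa [fx] using congrArg (fun T : Plane →L[ℝ] ℝ => T v) e0
  · have hv : v = v 0 • EuclideanSpace.single 0 1 + v 1 • EuclideanSpace.single 1 1 :=
      Plane.ext_coord (by simp) (by simp)
    have h1 := congrArg (fun T : Plane →L[ℝ] ℝ => T v) e1
    dsimp only at h1
    have h2 : fderivWithin ℝ (S.g i) unitSquare a v = S.gx i a * v 0 + S.gy i a * v 1 := by
      conv_lhs => rw [hv]
      rw [map_add, map_smul, map_smul, gx, gy, smul_eq_mul, smul_eq_mul]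
      ring
    exact Eq.trans h1 h2

theorem exists_hasFDerivWithinAt_lmap (w : List I) {a : Plane} (ha : a ∈ unitSquare) :
    ∃ L : Plane →L[ℝ] Plane, HasFDerivWithinAt (S.lmap w) L unitSquare a ∧
      ∀ v, L v 0 = S.cocycle S.fx w a * v 0 ∧
        L v 1 = S.shear w a * v 0 + S.cocycle S.gy w a * v 1 := by
  induction w with
  | nil => exact ⟨ContinuousLinearMap.id ℝ _, hasFDerivWithinAt_id _ _, fun v => by
      simp [cocycle, shear]⟩
  | cons i w ih =>
    obtain ⟨L, hL, hL'⟩ := ih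
    obtain ⟨T, hT, hT'⟩ := exists_hasFDerivWithinAt_map (S := S) i (lmap_mem w ha)
    refine ⟨T.comp L, hT.comp a hL fun b hb => lmap_mem w hb, fun v => ?_⟩
    rw [ContinuousLinearMap.comp_apply, (hT' _).1, (hT' _).2, (hL' _).1, (hL' _).2]
    simp only [cocycle, shear]
    constructor <;> ring

end NonlinearIFS

/-! ### Geometry of the maps S_w under bounded distortion. -/

namespace NonlinearIFS

variable {I : Type*} {S : NonlinearIFS I}

/-- Bounded distortion of the derivatives of the maps `S_w`. -/
structure WordBounds (S : NonlinearIFS I) (d c K : ℝ) : Prop where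
  d_pos : 0 < d
  c_pos : 0 < c
  c_lt_one : c < 1
  one_le_K : 1 ≤ K
  d_le_one : d ≤ 1
  xDeriv_le : ∀ w, ∀ a ∈ unitSquare, S.cocycle S.fx w a ≤ K * S.width w
  le_xDeriv : ∀ w, ∀ a ∈ unitSquare, S.width w ≤ K * S.cocycle S.fx w a
  yDeriv_le : ∀ w, ∀ a ∈ unitSquare, S.cocycle S.gy w a ≤ K * S.height w
  le_yDeriv : ∀ w, ∀ a ∈ unitSquare, S.height w ≤ K * S.cocycle S.gy w a
  shear_le : ∀ w, ∀ a ∈ unitSquare, |S.shear w a| ≤ K * S.width w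
  pow_le_height : ∀ w, d ^ w.length ≤ S.height w
  height_le_width : ∀ w, S.height w ≤ S.width w
  width_le_pow : ∀ w, S.width w ≤ c ^ w.length

theorem LetterBounds.exists_wordBounds [Nonempty I] {d c ρ M B θ : ℝ}
    (h : S.LetterBounds d c ρ M B θ) : ∃ K, S.WordBounds d c K := by
  have hd := h.d_pos
  have h0 := zero_mem_unitSquare
  set K₁ := Real.exp (B / d * 2 ^ θ * (1 - c ^ θ)⁻¹) with hK₁
  set Q := |M| / (d * (1 - ρ)) with hQ
  have hQ0 : 0 ≤ Q := by have := sub_pos.2 h.ρ_lt_one; positivity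
  have hK₁1 : 1 ≤ K₁ := Real.one_le_exp <| by
    have := h.B_nonneg
    have := h.c_nonneg
    have := sub_pos.2 (Real.rpow_lt_one h.c_nonneg h.c_lt_one h.θ_pos)
    positivity
  have hdc : d ≤ c :=
    (h.le_fx (Classical.arbitrary I) 0 h0).trans (h.fx_le _ 0 h0)
  have hK : K₁ ≤ K₁ * (1 + Q) := by nlinarith
  have hle : ∀ φ : I → Plane → ℝ, (∀ i, ∀ a ∈ unitSquare, d ≤ φ i a) →
      (∀ i, ∀ a ∈ unitSquare, ∀ b ∈ unitSquare, |φ i a - φ i b| ≤ B * dist a b ^ θ) →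
      ∀ w, ∀ a ∈ unitSquare, ∀ b ∈ unitSquare,
        S.cocycle φ w a ≤ K₁ * (1 + Q) * S.cocycle φ w b := fun φ hφ hφB w a ha b hb =>
    (h.cocycle_le_mul_cocycle hφ hφB w ha hb).trans
      (mul_le_mul_of_nonneg_right hK (cocycle_pos hd hφ w hb).le)
  refine ⟨K₁ * (1 + Q), hd, hd.trans_le hdc, h.c_lt_one, by nlinarith, hdc.trans h.c_lt_one.le,
    fun w a ha => hle _ h.le_fx h.fx_holder w a ha 0 h0,
    fun w a ha => hle _ h.le_fx h.fx_holder w 0 h0 a ha,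
    fun w a ha => hle _ h.le_gy h.gy_holder w a ha 0 h0,
    fun w a ha => hle _ h.le_gy h.gy_holder w 0 h0 a ha,
    fun w a ha => ?_,
    fun w => pow_le_cocycle hd h.le_gy w h0,
    fun w => cocycle_le_cocycle hd h.le_gy (fun i a ha => h.gy_le_fx i ha) w h0,
    fun w => cocycle_le_pow hd h.le_fx h.fx_le w h0⟩
  have hw : 0 < S.width w := cocycle_pos hd h.le_fx w h0
  calc |S.shear w a| ≤ Q * S.cocycle S.fx w a := h.abs_shear_le w ha
    _ ≤ Q * (K₁ * S.width w) := by
      gcongr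
      exact h.cocycle_le_mul_cocycle h.le_fx h.fx_holder w ha h0
    _ ≤ K₁ * (1 + Q) * S.width w := by
      have : 0 ≤ K₁ * S.width w := by positivity
      nlinarith

theorem lmap_zero_congr (w : List I) {a b : Plane} (h : a 0 = b 0) :
    S.lmap w a 0 = S.lmap w b 0 := by
  induction w with
  | nil => exact h
  | cons i w ih => simp only [lmap, map_apply_zero, ih]

/-- The mean value theorem is applied to each coordinate separately, hence two intermediate points.
This costs nothing, as the derivative bounds hold on the whole square. -/
theorem exists_mean_value (w : List I) {a b : Plane} (ha : a ∈ unitSquare) (hb : b ∈ unitSquare) :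
    (∃ ξ ∈ unitSquare, S.lmap w b 0 - S.lmap w a 0 = S.cocycle S.fx w ξ * (b 0 - a 0)) ∧
      ∃ ξ ∈ unitSquare, S.lmap w b 1 - S.lmap w a 1 =
        S.shear w ξ * (b 0 - a 0) + S.cocycle S.gy w ξ * (b 1 - a 1) := by
  choose! L hL hL' using fun (a : Plane) (ha : a ∈ unitSquare) =>
    exists_hasFDerivWithinAt_lmap (S := S) w ha
  have hj : ∀ j, ∃ ξ ∈ unitSquare, S.lmap w b j - S.lmap w a j = L ξ (b - a) j := fun j => by
    obtain ⟨ξ, hξ, h⟩ := domain_mvt (f := fun x => S.lmap w x j)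
      (f' := fun x => (EuclideanSpace.proj j : Plane →L[ℝ] ℝ).comp (L x))
      (fun x hx => hasFDerivWithinAt_euclidean.1 (hL x hx) j) convex_unitSquare ha hb
    exact ⟨ξ, convex_unitSquare.segment_subset ha hb hξ, h⟩
  obtain ⟨ξ, hξ, h0⟩ := hj 0
  obtain ⟨ζ, hζ, h1⟩ := hj 1
  exact ⟨⟨ξ, hξ, by rw [h0, (hL' ξ hξ _).1]; rfl⟩, ζ, hζ, by rw [h1, (hL' ζ hζ _).2]; rfl⟩

namespace WordBounds

variable {d c K : ℝ} (h : S.WordBounds d c K)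
include h

theorem K_pos : 0 < K := one_pos.trans_le h.one_le_K

theorem height_pos (w : List I) : 0 < S.height w := (pow_pos h.d_pos _).trans_le (h.pow_le_height w)

theorem width_pos (w : List I) : 0 < S.width w := (h.height_pos w).trans_le (h.height_le_width w)

theorem width_le_one (w : List I) : S.width w ≤ 1 :=
  (h.width_le_pow w).trans (pow_le_one₀ h.c_pos.le h.c_lt_one.le)

theorem height_le_pow (w : List I) : S.height w ≤ c ^ w.length :=
  (h.height_le_width w).trans (h.width_le_pow w)

theorem xDeriv_pos (w : List I) {a : Plane} (ha : a ∈ unitSquare) : 0 < S.cocycle S.fx w a :=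
  pos_of_mul_pos_right ((h.width_pos w).trans_le (h.le_xDeriv w a ha)) h.K_pos.le

theorem yDeriv_pos (w : List I) {a : Plane} (ha : a ∈ unitSquare) : 0 < S.cocycle S.gy w a :=
  pos_of_mul_pos_right ((h.height_pos w).trans_le (h.le_yDeriv w a ha)) h.K_pos.le

theorem width_append_le (u v : List I) : S.width (u ++ v) ≤ K * (S.width u * S.width v) := by
  have := h.xDeriv_le u _ (lmap_mem (S := S) v zero_mem_unitSquare)
  have h1 := h.width_pos v
  rw [width, cocycle_append, ← mul_assoc]
  exact mul_le_mul_of_nonneg_right this h1.le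

theorem le_width_append (u v : List I) : S.width u * S.width v ≤ K * S.width (u ++ v) := by
  have := h.le_xDeriv u _ (lmap_mem (S := S) v zero_mem_unitSquare)
  have h1 := h.width_pos v
  rw [width, width, width, cocycle_append, ← mul_assoc]
  exact mul_le_mul_of_nonneg_right this h1.le

theorem height_append_le (u v : List I) : S.height (u ++ v) ≤ K * (S.height u * S.height v) := by
  have := h.yDeriv_le u _ (lmap_mem (S := S) v zero_mem_unitSquare)
  have h1 := h.height_pos v
  rw [height, cocycle_append, ← mul_assoc]
  exact mul_le_mul_of_nonneg_right this h1.le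

theorem le_height_append (u v : List I) : S.height u * S.height v ≤ K * S.height (u ++ v) := by
  have := h.le_yDeriv u _ (lmap_mem (S := S) v zero_mem_unitSquare)
  have h1 := h.height_pos v
  rw [height, height, height, cocycle_append, ← mul_assoc]
  exact mul_le_mul_of_nonneg_right this h1.le

theorem abs_fst_sub_le (w : List I) {a b : Plane} (ha : a ∈ unitSquare) (hb : b ∈ unitSquare) :
    |S.lmap w a 0 - S.lmap w b 0| ≤ K * S.width w * |a 0 - b 0| := by
  obtain ⟨⟨ξ, hξ, e⟩, -⟩ := exists_mean_value (S := S) w hb ha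
  rw [e, abs_mul, abs_of_pos (h.xDeriv_pos w hξ)]
  gcongr
  exact h.xDeriv_le w ξ hξ

theorem mul_abs_fst_le (w : List I) {a b : Plane} (ha : a ∈ unitSquare) (hb : b ∈ unitSquare) :
    S.width w * |a 0 - b 0| ≤ K * |S.lmap w a 0 - S.lmap w b 0| := by
  obtain ⟨⟨ξ, hξ, e⟩, -⟩ := exists_mean_value (S := S) w hb ha
  rw [e, abs_mul, abs_of_pos (h.xDeriv_pos w hξ), ← mul_assoc]
  gcongr
  exact h.le_xDeriv w ξ hξ

theorem mul_fst_le (w : List I) {a b : Plane} (ha : a ∈ unitSquare) (hb : b ∈ unitSquare)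
    (hab : a 0 ≤ b 0) : S.width w * (b 0 - a 0) ≤ K * (S.lmap w b 0 - S.lmap w a 0) := by
  obtain ⟨⟨ξ, hξ, e⟩, -⟩ := exists_mean_value (S := S) w ha hb
  rw [e, ← mul_assoc]
  exact mul_le_mul_of_nonneg_right (h.le_xDeriv w ξ hξ) (sub_nonneg.2 hab)

theorem abs_snd_sub_le (w : List I) {a b : Plane} (ha : a ∈ unitSquare) (hb : b ∈ unitSquare) :
    |S.lmap w a 1 - S.lmap w b 1| ≤
      K * S.width w * |a 0 - b 0| + K * S.height w * |a 1 - b 1| := by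
  obtain ⟨-, ξ, hξ, e⟩ := exists_mean_value (S := S) w hb ha
  rw [e]
  refine (abs_add_le _ _).trans ?_
  rw [abs_mul, abs_mul, abs_of_pos (h.yDeriv_pos w hξ)]
  gcongr
  · exact h.shear_le w ξ hξ
  · exact h.yDeriv_le w ξ hξ

theorem mul_snd_le (w : List I) {a b : Plane} (ha : a ∈ unitSquare) (hb : b ∈ unitSquare)
    (h0 : a 0 = b 0) (hab : a 1 ≤ b 1) :
    S.height w * (b 1 - a 1) ≤ K * (S.lmap w b 1 - S.lmap w a 1) := by
  obtain ⟨-, ξ, hξ, e⟩ := exists_mean_value (S := S) w ha hb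
  rw [e, h0, sub_self, mul_zero, zero_add, ← mul_assoc]
  exact mul_le_mul_of_nonneg_right (h.le_yDeriv w ξ hξ) (sub_nonneg.2 hab)

theorem dist_lmap_le (w : List I) {a b : Plane} (ha : a ∈ unitSquare) (hb : b ∈ unitSquare) :
    dist (S.lmap w a) (S.lmap w b) ≤
      2 * K * S.width w * |a 0 - b 0| + K * S.height w * |a 1 - b 1| := by
  linarith [dist_le_abs_add_abs (S.lmap w a) (S.lmap w b), h.abs_fst_sub_le w ha hb,
    h.abs_snd_sub_le w ha hb]

/-- The first coordinate of S_w determines x; on a fixed vertical line the second coordinate is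
strictly increasing. -/
theorem injOn_lmap (w : List I) : InjOn (S.lmap w) unitSquare := by
  intro a ha b hb hab
  have e0 : a 0 = b 0 := by
    have h1 := h.mul_abs_fst_le w ha hb
    rw [hab, sub_self, abs_zero, mul_zero] at h1
    have h2 := h.width_pos w
    have h3 : |a 0 - b 0| ≤ 0 := nonpos_of_mul_nonpos_right h1 h2
    exact sub_eq_zero.1 (abs_nonpos_iff.1 h3)
  have key : ∀ {a b : Plane}, a ∈ unitSquare → b ∈ unitSquare → S.lmap w a = S.lmap w b →
      a 0 = b 0 → b 1 ≤ a 1 := fun {a b} ha hb hab e0 => by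
    by_contra! hlt
    have h1 := h.mul_snd_le w ha hb e0 hlt.le
    rw [hab, sub_self, mul_zero] at h1
    have h2 := mul_pos (h.height_pos w) (sub_pos.2 hlt)
    linarith
  exact Plane.ext_coord e0 (le_antisymm (key hb ha hab.symm e0.symm) (key ha hb hab e0))

/-- The sum of squares F² + C² + G² is of order W², because |C| and G are O(W) and F is comparable
to W; this fixes α₁. The product α₁α₂ = FG then fixes α₂. -/
theorem alpha_bounds {k : ℕ} (w : Fin k → I) {a : Plane} (ha : a ∈ unitSquare) :
    (S.alpha₁ w a ≤ 3 * K ^ 3 * S.width (List.ofFn w) ∧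
      S.width (List.ofFn w) ≤ 3 * K ^ 3 * S.alpha₁ w a) ∧
    (S.alpha₂ w a ≤ 3 * K ^ 3 * S.height (List.ofFn w) ∧
      S.height (List.ofFn w) ≤ 3 * K ^ 3 * S.alpha₂ w a) := by
  obtain ⟨L, hL, hL'⟩ := exists_hasFDerivWithinAt_lmap (S := S) (List.ofFn w) ha
  have e : S.jacobian w a = L := by
    rw [jacobian, wordMap_eq_lmap]
    exact hL.fderivWithin (uniqueDiffOn_unitSquare a ha)
  set F := S.cocycle S.fx (List.ofFn w) a with hF
  set G := S.cocycle S.gy (List.ofFn w) a with hG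
  set C := S.shear (List.ofFn w) a with hC
  obtain ⟨hsum, hprod⟩ := singularValues_plane (L : Plane →ₗ[ℝ] Plane) (F := F) (C := C) (G := G)
    (fun v => (hL' v).1) (fun v => (hL' v).2)
  have e1 : S.alpha₁ w a = (L : Plane →ₗ[ℝ] Plane).singularValues 0 := by rw [alpha₁, e]
  have e2 : S.alpha₂ w a = (L : Plane →ₗ[ℝ] Plane).singularValues 1 := by rw [alpha₂, e]
  have n1 : 0 ≤ S.alpha₁ w a := LinearMap.singularValues_nonneg _ _
  have n2 : 0 ≤ S.alpha₂ w a := LinearMap.singularValues_nonneg _ _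
  have n12 : S.alpha₂ w a ≤ S.alpha₁ w a := LinearMap.singularValues_antitone _ zero_le_one
  rw [← e1, ← e2] at hsum hprod
  have hFp : 0 < F := h.xDeriv_pos _ ha
  have hGp : 0 < G := h.yDeriv_pos _ ha
  rw [abs_of_pos (mul_pos hFp hGp)] at hprod
  have hW := h.width_pos (List.ofFn w)
  have hH := h.height_pos (List.ofFn w)
  have hHW := h.height_le_width (List.ofFn w)
  have hF1 : F ≤ K * S.width (List.ofFn w) := h.xDeriv_le _ a ha
  have hF2 : S.width (List.ofFn w) ≤ K * F := h.le_xDeriv _ a ha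
  have hG1 : G ≤ K * S.height (List.ofFn w) := h.yDeriv_le _ a ha
  have hG2 : S.height (List.ofFn w) ≤ K * G := h.le_yDeriv _ a ha
  have hC1 : |C| ≤ K * S.width (List.ofFn w) := h.shear_le _ a ha
  have hK := h.one_le_K
  have hK3 : K ≤ K ^ 3 := le_self_pow₀ hK (by norm_num)
  set W := S.width (List.ofFn w)
  set H := S.height (List.ofFn w)
  set α := S.alpha₁ w a
  set β := S.alpha₂ w a
  have hKW : 0 < K * W := mul_pos h.K_pos hW
  have b1 : α ≤ 3 * (K * W) := by
    refine abs_le_of_sq_le_sq' ?_ (by positivity) |>.2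
    have s1 : F ^ 2 ≤ (K * W) ^ 2 := pow_le_pow_left₀ hFp.le hF1 2
    have s2 : G ^ 2 ≤ (K * W) ^ 2 := pow_le_pow_left₀ hGp.le
      (hG1.trans (mul_le_mul_of_nonneg_left hHW h.K_pos.le)) 2
    have s3 : C ^ 2 ≤ (K * W) ^ 2 := by
      rw [← sq_abs C]; exact pow_le_pow_left₀ (abs_nonneg _) hC1 2
    nlinarith [sq_nonneg β, sq_nonneg (K * W)]
  have b2 : W ≤ 2 * (K * α) := by
    have : F ≤ 2 * α := by
      refine abs_le_of_sq_le_sq' ?_ (by positivity) |>.2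
      nlinarith [sq_nonneg C, sq_nonneg G]
    nlinarith [h.K_pos]
  have b3 : β ≤ 2 * (K ^ 3 * H) := by
    have : β * W ≤ 2 * (K ^ 3 * H) * W := by
      calc β * W ≤ β * (2 * (K * α)) := by gcongr
        _ = 2 * K * (F * G) := by rw [← hprod]; ring
        _ ≤ 2 * K * ((K * W) * (K * H)) := by
          have := h.K_pos
          gcongr
        _ = _ := by ring
    exact le_of_mul_le_mul_right this hW
  have b4 : H ≤ 3 * (K ^ 3 * β) := by
    have : W * H ≤ W * (3 * (K ^ 3 * β)) := by
      calc W * H ≤ (K * F) * (K * G) := by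
            have := h.K_pos
            gcongr
        _ = K ^ 2 * (α * β) := by rw [hprod]; ring
        _ ≤ K ^ 2 * (3 * (K * W) * β) := by gcongr
        _ = _ := by ring
    exact le_of_mul_le_mul_left this hW
  have hK3' : 0 < K ^ 3 := by have := h.K_pos; positivity
  refine ⟨⟨?_, ?_⟩, ?_, ?_⟩
  · nlinarith
  · nlinarith
  · nlinarith
  · linarith

end WordBounds

end NonlinearIFS

/-! ### Cylinders of the attractor. -/

theorem continuous_projX : Continuous projX := (EuclideanSpace.proj 0 : Plane →L[ℝ] ℝ).continuous

namespace NonlinearIFS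

variable {I : Type*} {S : NonlinearIFS I} {F : Set Plane}

theorem continuousOn_lmap (w : List I) : ContinuousOn (S.lmap w) unitSquare := fun a ha => by
  obtain ⟨L, hL, -⟩ := exists_hasFDerivWithinAt_lmap (S := S) w ha
  exact hL.continuousWithinAt

theorem IsAttractor.isCompact_image_lmap (hF : S.IsAttractor F) (w : List I) :
    IsCompact (S.lmap w '' F) :=
  hF.isCompact.image_of_continuousOn ((continuousOn_lmap w).mono hF.subset)

theorem IsAttractor.map_mem (hF : S.IsAttractor F) (i : I) {a : Plane} (ha : a ∈ F) :
    S.map i a ∈ F := by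
  rw [hF.eq_iUnion]
  exact mem_iUnion.2 ⟨i, a, ha, rfl⟩

theorem IsAttractor.lmap_mem (hF : S.IsAttractor F) (w : List I) {a : Plane} (ha : a ∈ F) :
    S.lmap w a ∈ F := by
  induction w with
  | nil => exact ha
  | cons i w ih => exact hF.map_mem i ih

theorem IsAttractor.lmap_image_subset (hF : S.IsAttractor F) (w : List I) : S.lmap w '' F ⊆ F := by
  rintro _ ⟨a, ha, rfl⟩
  exact hF.lmap_mem w ha

theorem IsAttractor.exists_append_singleton (hF : S.IsAttractor F) {w : List I} {x : Plane}
    (hx : x ∈ S.lmap w '' F) : ∃ i, x ∈ S.lmap (w ++ [i]) '' F := by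
  obtain ⟨y, hy, rfl⟩ := hx
  rw [hF.eq_iUnion] at hy
  obtain ⟨i, z, hz, rfl⟩ := mem_iUnion.1 hy
  exact ⟨i, z, hz, by rw [lmap_append]; rfl⟩

/-- A stopping-time argument: appending a letter lowers the weight by a factor of at least η, so it
cannot jump over [ηδ, δ]. If it never landed there, words through `x` of every length would have
weight above δ, contradicting N ≤ c^k. -/
theorem IsAttractor.exists_word_of_weight (hF : S.IsAttractor F) {N : List I → ℝ} {η c δ : ℝ}
    (hη : 0 < η) (hc1 : c < 1) (h0 : N [] = 1)
    (happ : ∀ w i, η * N w ≤ N (w ++ [i])) (hN : ∀ w, N w ≤ c ^ w.length)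
    (hδ : δ ∈ Ioo (0 : ℝ) 1) {x : Plane} (hx : x ∈ F) :
    ∃ w, x ∈ S.lmap w '' F ∧ η * δ ≤ N w ∧ N w ≤ δ := by
  by_contra! hcon
  have key : ∀ k : ℕ, ∃ w : List I, w.length = k ∧ x ∈ S.lmap w '' F ∧ δ < N w := by
    intro k
    induction k with
    | zero => exact ⟨[], rfl, ⟨x, hx, rfl⟩, by rw [h0]; exact hδ.2⟩
    | succ k ih =>
      obtain ⟨w, hw, hxw, hNw⟩ := ih
      obtain ⟨i, hi⟩ := hF.exists_append_singleton hxw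
      refine ⟨w ++ [i], by simp [hw], hi, hcon _ hi ?_⟩
      exact (mul_le_mul_of_nonneg_left hNw.le hη.le).trans (happ w i)
  obtain ⟨k, hk⟩ := exists_pow_lt_of_lt_one hδ.1 hc1
  obtain ⟨w, hw, -, hNw⟩ := key k
  have := hN w
  rw [hw] at this
  linarith

theorem IsAttractor.isCompact_projX (hF : S.IsAttractor F) : IsCompact (projX '' F) :=
  hF.isCompact.image continuous_projX

namespace WordBounds

variable {d c K : ℝ} (h : S.WordBounds d c K)
include h

theorem le_height_singleton (i : I) : d ≤ S.height [i] := by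
  simpa using h.pow_le_height [i]

theorem height_append_singleton (w : List I) (i : I) : d / K * S.height w ≤ S.height (w ++ [i]) := by
  have h1 := h.le_height_append w [i]
  have h2 := h.le_height_singleton i
  have h3 := h.height_pos w
  have h4 := h.K_pos
  rw [div_mul_eq_mul_div, div_le_iff₀ h4]
  nlinarith

theorem width_append_singleton (w : List I) (i : I) : d / K * S.width w ≤ S.width (w ++ [i]) := by
  have h1 := h.le_width_append w [i]
  have h2 := (h.le_height_singleton i).trans (h.height_le_width _)
  have h3 := h.width_pos w
  have h4 := h.K_pos
  rw [div_mul_eq_mul_div, div_le_iff₀ h4]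
  nlinarith

theorem exists_word_width (hF : S.IsAttractor F) {δ : ℝ} (hδ : δ ∈ Ioo (0 : ℝ) 1) {x : Plane}
    (hx : x ∈ F) : ∃ w, x ∈ S.lmap w '' F ∧ d / K * δ ≤ S.width w ∧ S.width w ≤ δ :=
  hF.exists_word_of_weight (div_pos h.d_pos h.K_pos) h.c_lt_one rfl
    h.width_append_singleton h.width_le_pow hδ hx

theorem exists_word_height (hF : S.IsAttractor F) {δ : ℝ} (hδ : δ ∈ Ioo (0 : ℝ) 1) {x : Plane}
    (hx : x ∈ F) : ∃ w, x ∈ S.lmap w '' F ∧ d / K * δ ≤ S.height w ∧ S.height w ≤ δ :=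
  hF.exists_word_of_weight (div_pos h.d_pos h.K_pos) h.c_lt_one rfl
    h.height_append_singleton h.height_le_pow hδ hx

end WordBounds

end NonlinearIFS

/-! ### Mesh counts and the box dimension of the projection. -/

theorem coverCount_div_two_pow_le {A : Set ℝ} (hA : TotallyBounded A) {δ : ℝ} (hδ : 0 < δ)
    (p : ℕ) : coverCount A (δ / 2 ^ p) ≤ 2 ^ p * coverCount A δ := by
  induction p with
  | zero => simp
  | succ p ih =>
    have := coverCount_half_le hA (δ := δ / 2 ^ p) (by positivity)
    rw [pow_succ, ← div_div, pow_succ' (2 : ℕ), mul_assoc]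
    exact this.trans (Nat.mul_le_mul_left 2 ih)

theorem coverCount_le_card_of_mesh {A : Set ℝ} {δ : ℝ} {T : Finset ℤ}
    (hT : ∀ x ∈ A, ∃ m ∈ T, x ∈ meshInterval δ m) : coverCount A δ ≤ T.card := by
  refine (coverCount_le_of_hasCover (hasCover_of_fintype (fun m : T => meshInterval δ m)
    (fun m => ?_) fun x hx => ?_)).trans_eq (Fintype.card_coe T)
  · rw [meshInterval, Real.ediam_Icc]
    exact ENNReal.ofReal_le_ofReal (by linarith)
  · obtain ⟨m, hm, hx⟩ := hT x hx
    exact mem_iUnion.2 ⟨⟨m, hm⟩, hx⟩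

theorem mem_meshInterval_floor {δ : ℝ} (hδ : 0 < δ) (x : ℝ) :
    x ∈ meshInterval δ ⌊x / δ⌋ := by
  have h1 := Int.floor_le (x / δ)
  have h2 := (Int.lt_floor_add_one (x / δ)).le
  rw [le_div_iff₀ hδ] at h1
  rw [div_le_iff₀ hδ] at h2
  exact ⟨h1, h2⟩

open Classical in
theorem sum_coverCount_mesh_le {A : Set ℝ} (hA : TotallyBounded A) {δ r : ℝ} (hr : 0 < r)
    (hrδ : r ≤ δ) (T : Finset ℤ) (B : ℤ → Set ℝ) (hBA : ∀ m ∈ T, B m ⊆ A)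
    (hB : ∀ m ∈ T, B m ⊆ Icc ((m - 1) * δ) ((m + 2) * δ)) :
    ∑ m ∈ T, coverCount (B m) r ≤ 6 * coverCount A r := by
  have hδ : 0 < δ := hr.trans_le hrδ
  refine sum_coverCount_le hA T B hBA hr 6 fun U hU => ?_
  rcases (T.filter fun m => (U ∩ B m).Nonempty).eq_empty_or_nonempty with he | ⟨m₀, hm₀⟩
  · rw [he]; simp
  obtain ⟨u₀, hu₀, -⟩ := (Finset.mem_filter.1 hm₀).2
  -- Each B_m reaches at most one cell beyond its own, and U has diameter at most one cell, which
  -- leaves six possible indices.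
  have hsub : (T.filter fun m => (U ∩ B m).Nonempty) ⊆
      Finset.Icc (⌊u₀ / δ⌋ - 3) (⌊u₀ / δ⌋ + 2) := by
    intro m hm
    obtain ⟨hmT, u, huU, huB⟩ := Finset.mem_filter.1 hm
    have h1 := abs_le.1 ((dist_le_of_ediam_le hr.le hU huU hu₀).trans hrδ)
    have h2 := hB m hmT huB
    have h3 := Int.floor_le (u₀ / δ)
    have h4 := Int.lt_floor_add_one (u₀ / δ)
    have h5 : (m - 1) * δ ≤ u₀ + δ := by linarith [h2.1]
    have h6 : u₀ - δ ≤ (m + 2) * δ := by linarith [h2.2]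
    have h7 : (m : ℝ) - 2 ≤ u₀ / δ := by rw [le_div_iff₀ hδ]; linarith
    have h8 : u₀ / δ ≤ m + 3 := by rw [div_le_iff₀ hδ]; linarith
    rw [Finset.mem_Icc]
    constructor
    · have : ((⌊u₀ / δ⌋ : ℤ) : ℝ) ≤ ((m + 3 : ℤ) : ℝ) := by push_cast; linarith
      have := Int.cast_le.1 this
      linarith
    · have : (m : ℝ) < ((⌊u₀ / δ⌋ + 3 : ℤ) : ℝ) := by push_cast; linarith
      have := Int.cast_lt.1 this
      linarith
  refine (Finset.card_le_card hsub).trans ?_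
  rw [Int.card_Icc]
  ring_nf
  simp

namespace NonlinearIFS

variable {I : Type*} {S : NonlinearIFS I} {F : Set Plane}

theorem IsAttractor.projX_subset (hF : S.IsAttractor F) : projX '' F ⊆ Icc 0 1 := by
  rintro _ ⟨a, ha, rfl⟩
  exact hF.subset ha 0

theorem IsAttractor.totallyBounded_projX (hF : S.IsAttractor F) : TotallyBounded (projX '' F) :=
  hF.isCompact_projX.totallyBounded

theorem IsAttractor.totallyBounded_projX_lmap (hF : S.IsAttractor F) (w : List I) :
    TotallyBounded (projX '' (S.lmap w '' F)) :=
  ((hF.isCompact_image_lmap w).image continuous_projX).totallyBounded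

/-- The projection of a cylinder of the attractor looks like a copy of the whole projection
rescaled by the width of the cylinder. -/
theorem WordBounds.coverCount_projX_le {d c K : ℝ} (h : S.WordBounds d c K)
    (hF : S.IsAttractor F) (w : List I) {r δ : ℝ} (hr : 0 < r) (hδ : K * r ≤ S.width w * δ) :
    coverCount (projX '' F) δ ≤ coverCount (projX '' (S.lmap w '' F)) r := by
  have := hF.totallyBounded_projX_lmap w
  rw [image_image] at this ⊢
  refine coverCount_image_le (A := F) (fun a => projX (S.lmap w a)) projX hr this
    fun a ha b hb hab => ?_
  have h1 := h.mul_abs_fst_le w (hF.subset ha) (hF.subset hb)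
  have h2 := mul_le_mul_of_nonneg_left hab h.K_pos.le
  exact le_of_mul_le_mul_left ((h1.trans h2).trans hδ) (h.width_pos w)

/-- For each mesh interval of length δ that meets πF, a cylinder of width about δ is chosen whose
projection meets it. That projection contains a copy of πF scaled by about δ, so at scale δr it
needs about N(πF, r) sets; the mesh bound lets these counts be added. -/
theorem WordBounds.exists_supermul {d c K : ℝ} (h : S.WordBounds d c K) (hF : S.IsAttractor F) :
    ∃ C > 0, ∀ δ ∈ Ioc (0 : ℝ) 1, ∀ r ∈ Ioc (0 : ℝ) 1,
      C * (coverCount (projX '' F) δ * coverCount (projX '' F) r) ≤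
        (coverCount (projX '' F) (δ * r) : ℝ) := by
  classical
  have hK := h.K_pos
  have hd := h.d_pos
  have hX := hF.totallyBounded_projX
  -- `D` is the loss between scale r on πF and scale δr on the chosen cylinder; p halvings, with 2^p
  -- > D, recover it.
  set D : ℝ := K * (2 * K) / (d / K) with hD
  have hD0 : 0 < D := by positivity
  obtain ⟨p, hp⟩ := pow_unbounded_of_one_lt D (one_lt_two)
  refine ⟨(6 * 2 ^ p)⁻¹, by positivity, fun δ hδ r hr => ?_⟩
  set T : Finset ℤ := (Finset.Icc 0 ⌊1 / δ⌋).filter fun m =>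
    (projX '' F ∩ meshInterval δ m).Nonempty with hT
  have hcov : coverCount (projX '' F) δ ≤ T.card := by
    refine coverCount_le_card_of_mesh fun x hx => ⟨⌊x / δ⌋, ?_,
      mem_meshInterval_floor hδ.1 x⟩
    have hx1 := hF.projX_subset hx
    refine Finset.mem_filter.2 ⟨Finset.mem_Icc.2 ⟨Int.floor_nonneg.2 (div_nonneg hx1.1 hδ.1.le),
      Int.floor_le_floor ?_⟩, x, hx, mem_meshInterval_floor hδ.1 x⟩
    have := hδ.1
    have := hx1.2
    gcongr
  have hw : ∀ m : ℤ, ∃ w : List I, m ∈ T →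
      (projX '' (S.lmap w '' F) ∩ meshInterval δ m).Nonempty ∧
      d / K * (δ / (2 * K)) ≤ S.width w ∧ S.width w ≤ δ / (2 * K) := fun m => by
    by_cases hm : m ∈ T
    · obtain ⟨_, ⟨a, ha, rfl⟩, hx⟩ := (Finset.mem_filter.1 hm).2
      -- With width at most δ/(2K) the projected cylinder has diameter at most δ/2, so it stays
      -- within the neighbouring mesh intervals.
      obtain ⟨w, haw, h1, h2⟩ := h.exists_word_width hF (δ := δ / (2 * K))
        ⟨by have := hδ.1; positivity, by
          rw [div_lt_one (by positivity)]; linarith [h.one_le_K, hδ.2]⟩ ha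
      exact ⟨w, fun _ => ⟨⟨projX a, ⟨a, haw, rfl⟩, hx⟩, h1, h2⟩⟩
    · exact ⟨[], fun h => absurd h hm⟩
  choose w hw using hw
  have hsum := sum_coverCount_mesh_le hX (mul_pos hδ.1 hr.1)
    (mul_le_of_le_one_right hδ.1.le hr.2) T (fun m => projX '' (S.lmap (w m) '' F))
    (fun m _ => image_mono (hF.lmap_image_subset (w m))) (fun m hm => by
      obtain ⟨⟨_, ⟨_, ⟨a, ha, rfl⟩, rfl⟩, hxm⟩, -, hle⟩ := hw m hm
      rintro _ ⟨_, ⟨b, hb, rfl⟩, rfl⟩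
      have h1 := h.abs_fst_sub_le (w m) (hF.subset hb) (hF.subset ha)
      have h2 : |b 0 - a 0| ≤ 1 := abs_le.2 ⟨by
        linarith [(hF.subset hb 0).1, (hF.subset ha 0).2], by
        linarith [(hF.subset hb 0).2, (hF.subset ha 0).1]⟩
      have h3 : K * S.width (w m) * |b 0 - a 0| ≤ δ := by
        calc K * S.width (w m) * |b 0 - a 0| ≤ K * (δ / (2 * K)) * 1 := by
              have := hδ.1
              gcongr
          _ = δ / 2 := by field_simp
          _ ≤ δ := by linarith [hδ.1]
      have h4 := abs_le.1 (h1.trans h3)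
      simp only [meshInterval, projX, mem_Icc] at hxm ⊢
      constructor <;> linarith [hxm.1, hxm.2])
  have hlow : ∀ m ∈ T, coverCount (projX '' F) r ≤
      2 ^ p * coverCount (projX '' (S.lmap (w m) '' F)) (δ * r) := fun m hm => by
    obtain ⟨-, hge, -⟩ := hw m hm
    have h1 : coverCount (projX '' F) (D * r) ≤
        coverCount (projX '' (S.lmap (w m) '' F)) (δ * r) := by
      refine h.coverCount_projX_le hF (w m) (mul_pos hδ.1 hr.1) ?_
      have := hr.1
      calc K * (δ * r) = d / K * (δ / (2 * K)) * (D * r) := by rw [hD]; field_simp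
        _ ≤ _ := by gcongr
    have h2 : coverCount (projX '' F) r ≤ coverCount (projX '' F) (D * r / 2 ^ p) := by
      have := hr.1
      refine coverCount_anti hX (by positivity) ?_
      rw [div_le_iff₀ (by positivity), mul_comm]
      gcongr
    exact h2.trans ((coverCount_div_two_pow_le hX (mul_pos hD0 hr.1) p).trans
      (Nat.mul_le_mul_left _ h1))
  have hfin : coverCount (projX '' F) δ * coverCount (projX '' F) r ≤
      6 * 2 ^ p * coverCount (projX '' F) (δ * r) := by
    calc coverCount (projX '' F) δ * coverCount (projX '' F) r
        ≤ T.card * coverCount (projX '' F) r := Nat.mul_le_mul_right _ hcov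
      _ = ∑ m ∈ T, coverCount (projX '' F) r := by simp
      _ ≤ ∑ m ∈ T, 2 ^ p * coverCount (projX '' (S.lmap (w m) '' F)) (δ * r) :=
        Finset.sum_le_sum hlow
      _ = 2 ^ p * ∑ m ∈ T, coverCount (projX '' (S.lmap (w m) '' F)) (δ * r) := by
        rw [Finset.mul_sum]
      _ ≤ 2 ^ p * (6 * coverCount (projX '' F) (δ * r)) := Nat.mul_le_mul_left _ hsum
      _ = _ := by ring
  rw [inv_mul_le_iff₀ (by positivity)]
  exact_mod_cast hfin

theorem WordBounds.exists_tendsto_projX {d c K : ℝ} (h : S.WordBounds d c K)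
    (hF : S.IsAttractor F) :
    ∃ s, Tendsto (fun δ : ℝ => Real.log (coverCount (projX '' F) δ) / (-Real.log δ)) (𝓝[>] 0)
      (𝓝 s) := by
  obtain ⟨C, hC, h1⟩ := h.exists_supermul hF
  exact exists_tendsto_of_coverCount_supermul hF.totallyBounded_projX (hF.nonempty.image _) hC h1

end NonlinearIFS

/-! ### The spectrum of the projected measure at q = 0. -/

namespace NonlinearIFS

variable {I : Type*} [Fintype I] {S : NonlinearIFS I} {F : Set Plane} {p : I → ℝ}
  {μ : Measure Plane}

/-- The maps are controlled only on the square, so measurability holds only almost everywhere, from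
continuity on the set `F` that carries μ. Without it the pushforwards in the self-similarity
equation would be zero by convention. -/
theorem IsNonlinearMeasure.aemeasurable_map (hF : S.IsAttractor F)
    (hμ : S.IsNonlinearMeasure F p μ) (i : I) : AEMeasurable (S.map i) μ := by
  have h1 : ContinuousOn (S.map i) F := by
    have := (continuousOn_lmap (S := S) [i]).mono hF.subset
    exact this
  have h2 : μ.restrict F = μ := Measure.restrict_eq_self_of_ae_mem
    (by rw [ae_iff]; exact hμ.compl_eq_zero)
  rw [← h2]
  exact h1.aemeasurable hF.isCompact.measurableSet

/-- One term of the invariance equation gives μ(S_i A) ≥ p_i μ(A) for a cylinder A; induct from μ(F)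
= 1. -/
theorem IsNonlinearMeasure.measure_lmap_pos (hF : S.IsAttractor F) (hp : ∀ i, 0 < p i)
    (hμ : S.IsNonlinearMeasure F p μ) (w : List I) : 0 < μ (S.lmap w '' F) := by
  induction w with
  | nil =>
    have := hμ.isProbabilityMeasure
    have h1 : μ F = 1 := (prob_compl_eq_zero_iff hF.isCompact.measurableSet).1 hμ.compl_eq_zero
    have h2 : S.lmap [] '' F = F := by simp [lmap]
    rw [h2, h1]
    exact one_pos
  | cons i w ih =>
    have e : S.lmap (i :: w) '' F = S.map i '' (S.lmap w '' F) := by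
      rw [image_image]; rfl
    have hm : MeasurableSet (S.lmap (i :: w) '' F) :=
      (hF.isCompact_image_lmap (i :: w)).measurableSet
    have h1 : ENNReal.ofReal (p i) * μ (S.lmap w '' F) ≤ μ (S.lmap (i :: w) '' F) := by
      calc ENNReal.ofReal (p i) * μ (S.lmap w '' F)
          ≤ ENNReal.ofReal (p i) * μ.map (S.map i) (S.lmap (i :: w) '' F) := by
            rw [Measure.map_apply_of_aemeasurable (hμ.aemeasurable_map hF i) hm, e]
            gcongr
            exact subset_preimage_image _ _
        _ ≤ ∑ j, ENNReal.ofReal (p j) * μ.map (S.map j) (S.lmap (i :: w) '' F) :=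
            Finset.single_le_sum
              (f := fun j => ENNReal.ofReal (p j) * μ.map (S.map j) (S.lmap (i :: w) '' F))
              (fun _ _ => zero_le) (Finset.mem_univ i)
        _ = μ (S.lmap (i :: w) '' F) := by
            conv_rhs => rw [hμ.eq_sum]
            simp [Measure.finsetSum_apply]
    exact (ENNReal.mul_pos (ENNReal.ofReal_pos.2 (hp i)).ne' ih.ne').trans_le h1

theorem WordBounds.measure_map_projX_Ioo_pos {d c K : ℝ} (h : S.WordBounds d c K)
    (hF : S.IsAttractor F) (hp : ∀ i, 0 < p i) (hμ : S.IsNonlinearMeasure F p μ) {x ε : ℝ}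
    (hx : x ∈ projX '' F) (hε : 0 < ε) : 0 < μ.map projX (Ioo (x - ε) (x + ε)) := by
  obtain ⟨a, ha, rfl⟩ := hx
  have hK := h.K_pos
  obtain ⟨w, ⟨b, hb, rfl⟩, -, hw⟩ := h.exists_word_width hF (δ := min (1 / 2) (ε / (2 * K)))
    ⟨by positivity, (min_le_left _ _).trans_lt (by norm_num)⟩ ha
  rw [Measure.map_apply continuous_projX.measurable measurableSet_Ioo]
  refine (hμ.measure_lmap_pos hF hp w).trans_le (measure_mono ?_)
  rintro _ ⟨e, he, rfl⟩
  have h1 := h.abs_fst_sub_le w (hF.subset he) (hF.subset hb)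
  have h2 : |e 0 - b 0| ≤ 1 := abs_le.2 ⟨by
    linarith [(hF.subset he 0).1, (hF.subset hb 0).2], by
    linarith [(hF.subset he 0).2, (hF.subset hb 0).1]⟩
  have h3 : K * S.width w * |e 0 - b 0| ≤ ε / 2 := by
    calc K * S.width w * |e 0 - b 0| ≤ K * (ε / (2 * K)) * 1 := by
          gcongr
          exact hw.trans (min_le_right _ _)
      _ = ε / 2 := by field_simp
  have h4 := abs_le.1 (h1.trans h3)
  simp only [projX, mem_preimage, mem_Ioo]
  constructor <;> linarith

theorem IsNonlinearMeasure.nonempty_inter_of_pos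
    (hμ : S.IsNonlinearMeasure F p μ) {Q : Set ℝ} (hQ : MeasurableSet Q)
    (h : 0 < μ.map projX Q) : (projX '' F ∩ Q).Nonempty := by
  rw [Measure.map_apply continuous_projX.measurable hQ] at h
  by_contra hne
  have : projX ⁻¹' Q ⊆ Fᶜ := fun a ha haF => hne ⟨projX a, mem_image_of_mem _ haF, ha⟩
  exact h.ne' (measure_mono_null this hμ.compl_eq_zero)

theorem measurableSet_meshInterval (δ : ℝ) (m : ℤ) : MeasurableSet (meshInterval δ m) :=
  measurableSet_Icc

theorem WordBounds.exists_mesh_pos {d c K : ℝ} (h : S.WordBounds d c K)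
    (hF : S.IsAttractor F) (hp : ∀ i, 0 < p i) (hμ : S.IsNonlinearMeasure F p μ) {x δ : ℝ}
    (hx : x ∈ projX '' F) (hδ : 0 < δ) :
    ∃ m : ℤ, 0 < μ.map projX (meshInterval δ m) ∧ x ∈ meshInterval δ m := by
  set m := ⌊x / δ⌋ with hm
  have hxm := mem_meshInterval_floor hδ x
  rw [← hm] at hxm
  have hlt : x < (m + 1) * δ := by
    have := Int.lt_floor_add_one (x / δ)
    rwa [← hm, div_lt_iff₀ hδ] at this
  rcases hxm.1.eq_or_lt with heq | hgt
  -- At a mesh point the mass near `x` may lie on one side only, so both adjacent closed intervals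
  -- are candidates.
  · have h1 := h.measure_map_projX_Ioo_pos hF hp hμ hx hδ
    by_contra! hcon
    have hz : ∀ k : ℤ, x ∈ meshInterval δ k → μ.map projX (meshInterval δ k) = 0 := fun k hk => by
      by_contra hne
      exact hcon k (pos_iff_ne_zero.2 hne) hk
    have h2 := hz m hxm
    have h3 := hz (m - 1) ⟨by push_cast; linarith, by push_cast; linarith⟩
    refine h1.ne' (measure_mono_null (fun y hy => ?_) (measure_union_null h3 h2))
    rcases le_total y (m * δ) with hle | hle
    · exact Or.inl ⟨by push_cast; linarith [hy.1], by push_cast; linarith⟩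
    · exact Or.inr ⟨hle, by linarith [hy.2]⟩
  · refine ⟨m, ?_, hxm⟩
    refine (h.measure_map_projX_Ioo_pos hF hp hμ hx (ε := min (x - m * δ) ((m + 1) * δ - x))
      (lt_min (by linarith) (by linarith))).trans_le (measure_mono fun y hy => ?_)
    exact ⟨by linarith [hy.1, min_le_left (x - m * δ) ((m + 1) * δ - x)],
      by linarith [hy.2, min_le_right (x - m * δ) ((m + 1) * δ - x)]⟩

/-- At q = 0 every term is 1, so the sum counts intervals of positive mass. They cover πF, and each
of them meets πF, so the mesh bound applies in the other direction. -/
theorem WordBounds.momentSum_zero_bounds {d c K : ℝ} (h : S.WordBounds d c K)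
    (hF : S.IsAttractor F) (hp : ∀ i, 0 < p i) (hμ : S.IsNonlinearMeasure F p μ) {δ : ℝ}
    (hδ : 0 < δ) : (coverCount (projX '' F) δ : ℝ) ≤ momentSum (μ.map projX) 0 δ ∧
      momentSum (μ.map projX) 0 δ ≤ 6 * coverCount (projX '' F) δ := by
  have hX := hF.totallyBounded_projX
  have hne := fun m hm => hμ.nonempty_inter_of_pos (measurableSet_meshInterval δ m) hm
  have hfin : {m : ℤ | 0 < μ.map projX (meshInterval δ m)}.Finite := by
    refine (Set.finite_Icc (-1) ⌊1 / δ⌋).subset fun m hm => ?_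
    obtain ⟨x, hxF, hx⟩ := hne m hm
    have hx1 := hF.projX_subset hxF
    constructor
    · have h1 : 0 ≤ ((m : ℝ) + 1) * δ := hx1.1.trans hx.2
      have h2 : (0 : ℝ) ≤ m + 1 := nonneg_of_mul_nonneg_left h1 hδ
      have h3 : (0 : ℤ) ≤ m + 1 := by exact_mod_cast h2
      linarith
    · rw [Int.le_floor, le_div_iff₀ hδ]
      exact hx.1.trans hx1.2
  have : Fintype {m : ℤ // 0 < μ.map projX (meshInterval δ m)} := hfin.fintype
  have hcard : momentSum (μ.map projX) 0 δ = (hfin.toFinset.card : ℝ) := by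
    rw [momentSum, tsum_fintype]
    simp only [Real.rpow_zero, Finset.sum_const, nsmul_eq_mul, mul_one, Finset.card_univ]
    rw [← Nat.card_eq_fintype_card, ← Nat.card_eq_card_finite_toFinset hfin]
    rfl
  rw [hcard]
  constructor
  · have := coverCount_le_card_of_mesh (A := projX '' F) (δ := δ) (T := hfin.toFinset)
      fun x hx => by
        obtain ⟨m, hm, hxm⟩ := h.exists_mesh_pos hF hp hμ hx hδ
        exact ⟨m, hfin.mem_toFinset.2 hm, hxm⟩
    exact_mod_cast this
  · have h1 := sum_coverCount_mesh_le hX hδ le_rfl hfin.toFinset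
      (fun m => projX '' F ∩ meshInterval δ m) (fun m _ => inter_subset_left)
      (fun m _ x hx => ⟨by nlinarith [hx.2.1], by nlinarith [hx.2.2]⟩)
    have h2 : hfin.toFinset.card ≤
        ∑ m ∈ hfin.toFinset, coverCount (projX '' F ∩ meshInterval δ m) δ := by
      rw [Finset.card_eq_sum_ones]
      refine Finset.sum_le_sum fun m hm => ?_
      exact one_le_coverCount (hX.subset inter_subset_left)
        (hne m (hfin.mem_toFinset.1 hm)) hδ
    exact_mod_cast h2.trans h1

theorem WordBounds.hasLqSpectrum_zero {d c K : ℝ} (h : S.WordBounds d c K)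
    (hF : S.IsAttractor F) (hp : ∀ i, 0 < p i) (hμ : S.IsNonlinearMeasure F p μ) {s : ℝ}
    (hs : Tendsto (fun δ : ℝ => Real.log (coverCount (projX '' F) δ) / (-Real.log δ)) (𝓝[>] 0)
      (𝓝 s)) : HasLqSpectrum (μ.map projX) 0 s := by
  have h6 : Tendsto (fun δ : ℝ => Real.log 6 / (-Real.log δ) +
      Real.log (coverCount (projX '' F) δ) / (-Real.log δ)) (𝓝[>] 0) (𝓝 s) := by
    simpa using (tendsto_const_nhds.div_atTop tendsto_neg_log_nhdsGT).add hs
  refine tendsto_of_tendsto_of_tendsto_of_le_of_le' hs h6 ?_ ?_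
  all_goals
    filter_upwards [eventually_Ioo_nhdsGT one_pos] with δ hδ
    obtain ⟨h1, h2⟩ := h.momentSum_zero_bounds hF hp hμ hδ.1
    have hlog : 0 < -Real.log δ := neg_pos.2 (Real.log_neg hδ.1 hδ.2)
    have hN : (0 : ℝ) < coverCount (projX '' F) δ := by
      exact_mod_cast one_le_coverCount hF.totallyBounded_projX (hF.nonempty.image _) hδ.1
  · gcongr
  · rw [← add_div, ← Real.log_mul (by norm_num) hN.ne']
    have := hN.trans_le h1
    gcongr

end NonlinearIFS

/-! ### Weights, pressure and its zero. -/

theorem Real.rpow_le_of_comparable {x y A : ℝ} (hx : 0 < x) (hy : 0 < y) (hA : 1 ≤ A)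
    (hxy : x ≤ A * y) (hyx : y ≤ A * x) (e : ℝ) : x ^ e ≤ A ^ |e| * y ^ e := by
  have hA0 : 0 < A := one_pos.trans_le hA
  rcases le_total 0 e with he | he
  · rw [abs_of_nonneg he, ← Real.mul_rpow hA0.le hy.le]
    exact Real.rpow_le_rpow hx.le hxy he
  · rw [abs_of_nonpos he, Real.rpow_neg hA0.le, ← Real.inv_rpow hA0.le,
      ← Real.mul_rpow (by positivity) hy.le]
    refine Real.rpow_le_rpow_of_nonpos (by positivity) ?_ he
    rwa [inv_mul_le_iff₀ hA0]

/-- The upper slope `u < 0` makes L strictly decreasing, the two slope bounds make it Lipschitz, and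
the upper slope forces a sign change. -/
theorem exists_unique_zero_of_slopes {L : ℝ → ℝ} {l u : ℝ} (hu : u < 0)
    (hle : ∀ s h, 0 ≤ h → L (s + h) ≤ L s + h * u) (hge : ∀ s h, 0 ≤ h → L s + h * l ≤ L (s + h)) :
    ∃ γ, (∀ s, L s = 0 ↔ s = γ) ∧ (∀ s < γ, 0 < L s) ∧ ∀ s, γ < s → L s < 0 := by
  have hanti : StrictAnti L := fun x y hxy => by
    have := hle x (y - x) (by linarith)
    rw [add_sub_cancel] at this
    nlinarith
  have hcont : Continuous L := by
    refine (LipschitzWith.of_le_add_mul (K := Real.toNNReal |l|) fun x y => ?_).continuous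
    rw [Real.coe_toNNReal _ (abs_nonneg _), Real.dist_eq]
    rcases le_total x y with hxy | hxy
    · have h1 := hge x (y - x) (by linarith)
      rw [add_sub_cancel] at h1
      rw [abs_of_nonpos (by linarith : x - y ≤ 0)]
      nlinarith [neg_abs_le l]
    · have := hanti.antitone hxy
      nlinarith [mul_nonneg (abs_nonneg l) (abs_nonneg (x - y))]
  -- Over a length `T` the function drops by at least |L 0|, so it changes sign on [-T, T].
  set T := |L 0| / (-u) with hT
  have hu' : 0 < -u := neg_pos.2 hu
  have hu0 : u ≠ 0 := hu.ne
  have hT0 : 0 ≤ T := by positivity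
  have hTu : T * u = -|L 0| := by rw [hT]; field_simp
  have h1 : L T ≤ 0 := by
    have := hle 0 T hT0
    rw [zero_add, hTu] at this
    linarith [le_abs_self (L 0)]
  have h2 : 0 ≤ L (-T) := by
    have := hle (-T) T hT0
    rw [neg_add_cancel, hTu] at this
    linarith [neg_abs_le (L 0)]
  obtain ⟨γ, -, hγ⟩ := intermediate_value_Icc' (by linarith : -T ≤ T) hcont.continuousOn ⟨h1, h2⟩
  refine ⟨γ, fun s => ⟨fun h => hanti.injective (h.trans hγ.symm), fun h => h ▸ hγ⟩,
    fun s hs => hγ ▸ hanti hs, fun s hs => hγ ▸ hanti hs⟩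

namespace NonlinearIFS

variable {I : Type*} {S : NonlinearIFS I}

/-- The comparison weight `width(w)^β height(w)^(s-β)` of a word. -/
noncomputable def weight (S : NonlinearIFS I) (β s : ℝ) (w : List I) : ℝ :=
  S.width w ^ β * S.height w ^ (s - β)

/-- The sum of the comparison weights over the words of length `k`. -/
noncomputable def levelSum [Fintype I] (S : NonlinearIFS I) (β s : ℝ) (k : ℕ) : ℝ :=
  ∑ w : Fin k → I, S.weight β s (List.ofFn w)

theorem sum_words_add [Fintype I] {M : Type*} [AddCommMonoid M] (φ : List I → M) (m n : ℕ) :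
    ∑ w : Fin (m + n) → I, φ (List.ofFn w) =
      ∑ u : Fin m → I, ∑ v : Fin n → I, φ (List.ofFn u ++ List.ofFn v) := by
  rw [← Fintype.sum_prod_type', ← (Fin.appendEquiv (α := I) m n).sum_comp]
  refine Finset.sum_congr rfl fun x _ => ?_
  rw [← List.ofFn_fin_append]
  rfl

namespace WordBounds

variable {d c K : ℝ} (h : S.WordBounds d c K)
include h

theorem weight_pos (β s : ℝ) (w : List I) : 0 < S.weight β s w :=
  mul_pos (Real.rpow_pos_of_pos (h.width_pos w) _) (Real.rpow_pos_of_pos (h.height_pos w) _)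

theorem weight_append_le (β s : ℝ) (u v : List I) :
    S.weight β s (u ++ v) ≤ K ^ |β| * K ^ |s - β| * (S.weight β s u * S.weight β s v) := by
  have w1 := h.width_pos u
  have w2 := h.width_pos v
  have h1 := h.height_pos u
  have h2 := h.height_pos v
  have h3 := h.height_pos (u ++ v)
  have hK := h.K_pos
  have e1 := Real.rpow_le_of_comparable (h.width_pos _) (mul_pos w1 w2) h.one_le_K
    (h.width_append_le u v) (h.le_width_append u v) β
  have e2 := Real.rpow_le_of_comparable (h.height_pos _) (mul_pos h1 h2) h.one_le_K
    (h.height_append_le u v) (h.le_height_append u v) (s - β)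
  rw [Real.mul_rpow w1.le w2.le] at e1
  rw [Real.mul_rpow h1.le h2.le] at e2
  refine (mul_le_mul e1 e2 (by positivity) (by positivity)).trans_eq ?_
  simp only [weight]
  ring

theorem le_weight_append (β s : ℝ) (u v : List I) :
    S.weight β s u * S.weight β s v ≤ K ^ |β| * K ^ |s - β| * S.weight β s (u ++ v) := by
  have w1 := h.width_pos u
  have w2 := h.width_pos v
  have h1 := h.height_pos u
  have h2 := h.height_pos v
  have w3 := h.width_pos (u ++ v)
  have hK := h.K_pos
  have e1 := Real.rpow_le_of_comparable (mul_pos w1 w2) (h.width_pos _) h.one_le_K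
    (h.le_width_append u v) (h.width_append_le u v) β
  have e2 := Real.rpow_le_of_comparable (mul_pos h1 h2) (h.height_pos _) h.one_le_K
    (h.le_height_append u v) (h.height_append_le u v) (s - β)
  rw [Real.mul_rpow w1.le w2.le] at e1
  rw [Real.mul_rpow h1.le h2.le] at e2
  refine Eq.trans_le ?_ ((mul_le_mul e1 e2 (by positivity) (by positivity)).trans_eq ?_)
  all_goals
    simp only [weight]
    ring

/-- At q = 0 the probability factor is 1; this is why γ(0) does not depend on `p`. -/
theorem psi_bounds (p : I → ℝ) (β s : ℝ) {a : Plane} (ha : a ∈ unitSquare) {k : ℕ}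
    (w : Fin k → I) :
    S.psi p β s 0 a w ≤
      (3 * K ^ 3) ^ |β| * (3 * K ^ 3) ^ |s - β| * S.weight β s (List.ofFn w) ∧
    S.weight β s (List.ofFn w) ≤
      (3 * K ^ 3) ^ |β| * (3 * K ^ 3) ^ |s - β| * S.psi p β s 0 a w := by
  obtain ⟨⟨h1, h2⟩, h3, h4⟩ := h.alpha_bounds w ha
  have hA : 1 ≤ 3 * K ^ 3 := by linarith [one_le_pow₀ h.one_le_K (n := 3)]
  have hA0 : 0 < 3 * K ^ 3 := one_pos.trans_le hA
  have w1 := h.width_pos (List.ofFn w)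
  have w2 := h.height_pos (List.ofFn w)
  have a1 : 0 < S.alpha₁ w a := pos_of_mul_pos_right (w1.trans_le h2) hA0.le
  have a2 : 0 < S.alpha₂ w a := pos_of_mul_pos_right (w2.trans_le h4) hA0.le
  rw [psi, Real.rpow_zero, one_mul, weight]
  constructor
  · refine (mul_le_mul (Real.rpow_le_of_comparable a1 w1 hA h1 h2 β)
      (Real.rpow_le_of_comparable a2 w2 hA h3 h4 (s - β)) (by positivity)
      (by positivity)).trans_eq (by ring)
  · refine (mul_le_mul (Real.rpow_le_of_comparable w1 a1 hA h2 h1 β)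
      (Real.rpow_le_of_comparable w2 a2 hA h4 h3 (s - β)) (by positivity)
      (by positivity)).trans_eq (by ring)

variable [Fintype I] [Nonempty I]

theorem levelSum_pos (β s : ℝ) (k : ℕ) : 0 < S.levelSum β s k :=
  Finset.sum_pos (fun _ _ => h.weight_pos β s _) Finset.univ_nonempty

omit [Nonempty I] in
theorem levelSum_add_le (β s : ℝ) (m n : ℕ) : S.levelSum β s (m + n) ≤
    K ^ |β| * K ^ |s - β| * (S.levelSum β s m * S.levelSum β s n) := by
  rw [levelSum, sum_words_add, levelSum, levelSum, Finset.sum_mul_sum, Finset.mul_sum]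
  refine Finset.sum_le_sum fun u _ => ?_
  rw [Finset.mul_sum]
  exact Finset.sum_le_sum fun v _ => h.weight_append_le β s _ _

omit [Nonempty I] in
theorem le_levelSum_add (β s : ℝ) (m n : ℕ) : S.levelSum β s m * S.levelSum β s n ≤
    K ^ |β| * K ^ |s - β| * S.levelSum β s (m + n) := by
  rw [levelSum, levelSum, levelSum, sum_words_add, Finset.sum_mul_sum, Finset.mul_sum]
  refine Finset.sum_le_sum fun u _ => ?_
  rw [Finset.mul_sum]
  exact Finset.sum_le_sum fun v _ => h.le_weight_append β s _ _

/-- Supermultiplicativity up to a constant drives Fekete's lemma; submultiplicativity supplies the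
linear upper bound it needs. -/
theorem exists_tendsto_log_levelSum (β s : ℝ) :
    ∃ L, Tendsto (fun k : ℕ => Real.log (S.levelSum β s k) / k) atTop (𝓝 L) := by
  have hK := h.K_pos
  have hpos := h.levelSum_pos β s
  set C := K ^ |β| * K ^ |s - β| with hC
  have hC0 : 0 < C := by positivity
  have hsub : ∀ m n, Real.log (S.levelSum β s m) + Real.log (S.levelSum β s n) ≤
      Real.log (S.levelSum β s (m + n)) + Real.log C := fun m n => by
    rw [← Real.log_mul (hpos m).ne' (hpos n).ne', ← Real.log_mul (hpos _).ne' hC0.ne']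
    refine Real.log_le_log (mul_pos (hpos m) (hpos n)) ?_
    rw [mul_comm (S.levelSum β s (m + n))]
    exact h.le_levelSum_add β s m n
  have hsup : ∀ n, Real.log (S.levelSum β s (n + 1)) ≤ Real.log C +
      (Real.log (S.levelSum β s n) + Real.log (S.levelSum β s 1)) := fun n => by
    rw [← Real.log_mul (hpos n).ne' (hpos 1).ne', ← Real.log_mul hC0.ne'
      (mul_pos (hpos n) (hpos 1)).ne']
    exact Real.log_le_log (hpos _) (h.levelSum_add_le β s n 1)
  have hle : ∀ n : ℕ, Real.log (S.levelSum β s n) ≤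
      (Real.log C + Real.log (S.levelSum β s 1)) * n + Real.log (S.levelSum β s 0) := fun n => by
    induction n with
    | zero => simp
    | succ n ih => push_cast; linarith [hsup n]
  exact tendsto_div_of_subadditive_of_le (M := max (Real.log C + Real.log (S.levelSum β s 1))
    (Real.log (S.levelSum β s 0))) hsub fun n => (hle n).trans (by
      gcongr
      · exact le_max_left _ _
      · exact le_max_right _ _)

omit [Fintype I] [Nonempty I] in
theorem weight_add (β s t : ℝ) (w : List I) :
    S.weight β (s + t) w = S.weight β s w * S.height w ^ t := by
  rw [weight, weight, mul_assoc, ← Real.rpow_add (h.height_pos w)]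
  ring_nf

theorem log_levelSum_add_le (β s : ℝ) {t : ℝ} (ht : 0 ≤ t) (k : ℕ) :
    Real.log (S.levelSum β (s + t) k) ≤ Real.log (S.levelSum β s k) + k * (t * Real.log c) := by
  have hc := h.c_pos
  have e : (k : ℝ) * (t * Real.log c) = Real.log ((c ^ k) ^ t) := by
    rw [Real.log_rpow (by positivity), Real.log_pow]; ring
  rw [e, ← Real.log_mul (h.levelSum_pos β s k).ne' (by positivity)]
  refine Real.log_le_log (h.levelSum_pos _ _ _) ?_
  rw [levelSum, levelSum, Finset.sum_mul]
  refine Finset.sum_le_sum fun w _ => ?_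
  rw [h.weight_add]
  have h1 := h.weight_pos β s (List.ofFn w)
  have h2 := h.height_le_pow (List.ofFn w)
  have h3 := h.height_pos (List.ofFn w)
  rw [List.length_ofFn] at h2
  gcongr

theorem le_log_levelSum_add (β s : ℝ) {t : ℝ} (ht : 0 ≤ t) (k : ℕ) :
    Real.log (S.levelSum β s k) + k * (t * Real.log d) ≤ Real.log (S.levelSum β (s + t) k) := by
  have hd := h.d_pos
  have e : (k : ℝ) * (t * Real.log d) = Real.log ((d ^ k) ^ t) := by
    rw [Real.log_rpow (by positivity), Real.log_pow]; ring
  have hs := h.levelSum_pos β s k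
  rw [e, ← Real.log_mul hs.ne' (by positivity)]
  refine Real.log_le_log (by positivity) ?_
  rw [levelSum, levelSum, Finset.sum_mul]
  refine Finset.sum_le_sum fun w _ => ?_
  rw [h.weight_add]
  have h1 := h.weight_pos β s (List.ofFn w)
  have h2 := h.pow_le_height (List.ofFn w)
  rw [List.length_ofFn] at h2
  gcongr

/-- Raising s by t multiplies each weight at level k by H^t, which lies between d^(kt) and c^(kt);
in the limit these are the slope bounds log d and log c. -/
theorem exists_pressure (β : ℝ) : ∃ (L : ℝ → ℝ) (γ : ℝ),
    (∀ s, Tendsto (fun k : ℕ => Real.log (S.levelSum β s k) / k) atTop (𝓝 (L s))) ∧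
      (∀ s, L s = 0 ↔ s = γ) ∧ (∀ s < γ, 0 < L s) ∧ ∀ s, γ < s → L s < 0 := by
  choose L hL using h.exists_tendsto_log_levelSum β
  have hconst : ∀ x : ℝ, Tendsto (fun k : ℕ => (k : ℝ) * x / k) atTop (𝓝 x) := fun x =>
    tendsto_const_nhds.congr' (by
      filter_upwards [eventually_ne_atTop 0] with k hk
      have : (k : ℝ) ≠ 0 := by exact_mod_cast hk
      field_simp)
  obtain ⟨γ, h1, h2, h3⟩ := exists_unique_zero_of_slopes (L := L) (l := Real.log d)
    (Real.log_neg h.c_pos h.c_lt_one)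
    (fun s t ht => le_of_tendsto_of_tendsto' (hL (s + t)) ((hL s).add (hconst _)) fun k => by
      rw [← add_div]
      exact div_le_div_of_nonneg_right (h.log_levelSum_add_le β s ht k) (Nat.cast_nonneg k))
    (fun s t ht => le_of_tendsto_of_tendsto' ((hL s).add (hconst _)) (hL (s + t)) fun k => by
      rw [← add_div]
      exact div_le_div_of_nonneg_right (h.le_log_levelSum_add β s ht k) (Nat.cast_nonneg k))
  exact ⟨L, γ, hL, h1, h2, h3⟩

theorem tendsto_Psi_rpow (p : I → ℝ) {β s L : ℝ}
    (hL : Tendsto (fun k : ℕ => Real.log (S.levelSum β s k) / k) atTop (𝓝 L))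
    {a : Plane} (ha : a ∈ unitSquare) :
    Tendsto (fun k : ℕ => S.Psi p β s 0 a k ^ (1 / (k : ℝ))) atTop (𝓝 (Real.exp L)) := by
  have hK := h.K_pos
  set C := (3 * K ^ 3) ^ |β| * (3 * K ^ 3) ^ |s - β| with hC
  have hC0 : 0 < C := by positivity
  have h1 : ∀ k, S.Psi p β s 0 a k ≤ C * S.levelSum β s k := fun k => by
    rw [Psi, levelSum, Finset.mul_sum]
    exact Finset.sum_le_sum fun w _ => (h.psi_bounds p β s ha w).1
  have h2 : ∀ k, S.levelSum β s k ≤ C * S.Psi p β s 0 a k := fun k => by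
    rw [Psi, levelSum, Finset.mul_sum]
    exact Finset.sum_le_sum fun w _ => (h.psi_bounds p β s ha w).2
  have h3 : ∀ k, 0 < S.Psi p β s 0 a k := fun k =>
    pos_of_mul_pos_right ((h.levelSum_pos β s k).trans_le (h2 k)) hC0.le
  have hz : Tendsto (fun k : ℕ => Real.log C / k) atTop (𝓝 0) :=
    tendsto_const_nhds.div_atTop tendsto_natCast_atTop_atTop
  have h4 : Tendsto (fun k : ℕ => Real.log (S.Psi p β s 0 a k) / k) atTop (𝓝 L) := by
    refine tendsto_of_tendsto_of_tendsto_of_le_of_le (by simpa using hL.sub hz)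
      (by simpa using hL.add hz) (fun k => ?_) fun k => ?_
    · dsimp only
      rw [← sub_div]
      refine div_le_div_of_nonneg_right ?_ (Nat.cast_nonneg k)
      have := Real.log_le_log (h.levelSum_pos β s k) (h2 k)
      rw [Real.log_mul hC0.ne' (h3 k).ne'] at this
      linarith
    · dsimp only
      rw [← add_div]
      refine div_le_div_of_nonneg_right ?_ (Nat.cast_nonneg k)
      have := Real.log_le_log (h3 k) (h1 k)
      rw [Real.log_mul hC0.ne' (h.levelSum_pos β s k).ne'] at this
      linarith
  refine ((Real.continuous_exp.tendsto L).comp h4).congr fun k => ?_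
  rw [Function.comp_apply, Real.rpow_def_of_pos (h3 k), mul_one_div]

theorem isMomentScaling_zero (p : I → ℝ) {β γ : ℝ} {L : ℝ → ℝ}
    (hL : ∀ s, Tendsto (fun k : ℕ => Real.log (S.levelSum β s k) / k) atTop (𝓝 (L s)))
    (hγ : ∀ s, L s = 0 ↔ s = γ) : S.IsMomentScaling p β 0 γ :=
  ⟨fun s => Real.exp (L s), fun _ ha s => h.tendsto_Psi_rpow p (hL s) ha, fun s => by
    rw [Real.exp_eq_one_iff, hγ]⟩

end WordBounds

end NonlinearIFS

/-! ### The upper bound. -/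

namespace NonlinearIFS

variable {I : Type*} {S : NonlinearIFS I} {F : Set Plane}

namespace WordBounds

variable {d c K : ℝ} (h : S.WordBounds d c K)
include h

theorem coverCount_lmap_le (hF : S.IsAttractor F) (w : List I) {r δ : ℝ} (hr : 0 < r)
    (hδ : 2 * K * S.width w * r + K * S.height w ≤ δ) :
    coverCount (S.lmap w '' F) δ ≤ coverCount (projX '' F) r := by
  refine coverCount_image_le projX (S.lmap w) hr hF.totallyBounded_projX fun a ha b hb hab => ?_
  have ha' := hF.subset ha
  have hb' := hF.subset hb
  have h1 : |a 1 - b 1| ≤ 1 := abs_le.2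
    ⟨by linarith [(ha' 1).1, (hb' 1).2], by linarith [(ha' 1).2, (hb' 1).1]⟩
  have h2 : |a 0 - b 0| ≤ r := hab
  have hK := h.K_pos
  have hW := h.width_pos w
  have hH := h.height_pos w
  refine (h.dist_lmap_le w ha' hb').trans (le_trans ?_ hδ)
  calc 2 * K * S.width w * |a 0 - b 0| + K * S.height w * |a 1 - b 1|
      ≤ 2 * K * S.width w * r + K * S.height w * 1 := by gcongr
    _ = _ := by ring

theorem summable_levelSum [Fintype I] [Nonempty I] {β t L : ℝ} (hL0 : L < 0)
    (hL : Tendsto (fun k : ℕ => Real.log (S.levelSum β t k) / k) atTop (𝓝 L)) :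
    Summable (S.levelSum β t) := by
  have h1 : Real.exp (L / 2) < 1 := by rw [← Real.exp_zero, Real.exp_lt_exp]; linarith
  refine Summable.of_norm_bounded_eventually_nat
    (summable_geometric_of_lt_one (Real.exp_pos _).le h1) ?_
  filter_upwards [hL.eventually (gt_mem_nhds (by linarith : L < L / 2)), eventually_gt_atTop 0]
    with k hk hk0
  have hk0' : (0 : ℝ) < k := by exact_mod_cast hk0
  have hp := h.levelSum_pos β t k
  rw [div_lt_iff₀ hk0'] at hk
  rw [Real.norm_of_nonneg hp.le, ← Real.exp_nat_mul, ← Real.log_le_iff_le_exp hp]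
  linarith

/-- The cost of one cylinder at the scale of its height: N(πF, δ/W) is at most about (W/δ)^(β+ε),
and H^(t-β) is exchanged for δ^(t-β). -/
theorem exists_coverCount_lmap_le (hF : S.IsAttractor F) {β : ℝ} (t : ℝ) {ε : ℝ}
    (hβ : Tendsto (fun δ : ℝ => Real.log (coverCount (projX '' F) δ) / (-Real.log δ)) (𝓝[>] 0)
      (𝓝 β)) (hε0 : 0 < ε) : ∃ C > 0, ∀ δ > 0, ∀ w,
      d / K * (δ / (2 * K)) ≤ S.height w → S.height w ≤ δ / (2 * K) →
      (coverCount (S.lmap w '' F) δ : ℝ) ≤ C * δ ^ (-(t + ε)) * S.weight β t w := by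
  have hK := h.K_pos
  have hK1 := h.one_le_K
  have hd := h.d_pos
  have hd1 := h.d_le_one
  set A := 2 * K ^ 2 / d with hA
  have hA0 : 0 < A := by positivity
  have hA1 : 1 ≤ A := by rw [hA, le_div_iff₀ hd]; nlinarith
  obtain ⟨C₁, hC₁, hX⟩ := exists_coverCount_le_of_tendsto hF.totallyBounded_projX
    (hF.nonempty.image _) hβ (t := β + ε) (by linarith) (K / (2 * d))
  set C := C₁ * (4 * K) ^ (β + ε) * A ^ |β - t| with hC
  have hC0 : 0 < C := by positivity
  refine ⟨C, hC0, fun δ hδ0 w h1 h2 => ?_⟩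
  have hH := h.height_pos w
  have hW := h.width_pos w
  have hHW := h.height_le_width w
  have hW1 := h.width_le_one w
  -- Chosen so that the horizontal extent contributes δ/2; the height bound gives the other δ/2.
  set r := δ / (4 * K * S.width w) with hr
  have hr0 : 0 < r := by positivity
  have hrR : r ≤ K / (2 * d) := by
    rw [hr, div_le_div_iff₀ (by positivity) (by positivity)]
    have h3 := h1.trans hHW
    rw [div_mul_div_comm, div_le_iff₀ (by positivity)] at h3
    nlinarith
  have h3 : coverCount (S.lmap w '' F) δ ≤ coverCount (projX '' F) r := by
    refine h.coverCount_lmap_le hF w hr0 ?_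
    rw [le_div_iff₀ (by positivity)] at h2
    have : 2 * K * S.width w * r = δ / 2 := by rw [hr]; field_simp; norm_num
    linarith
  have hcmp : S.height w ^ (β - t) ≤ A ^ |β - t| * δ ^ (β - t) := by
    refine Real.rpow_le_of_comparable hH hδ0 hA1 ?_ ?_ _
    · have : δ / (2 * K) ≤ δ := div_le_self hδ0.le (by linarith)
      nlinarith
    · have := mul_le_mul_of_nonneg_left h1 hA0.le
      refine Eq.trans_le ?_ this
      rw [hA]; field_simp
  have hWβ : S.width w ^ β = S.weight β t w * S.height w ^ (β - t) := by
    rw [weight, mul_assoc, ← Real.rpow_add hH]; simp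
  have hwt := h.weight_pos β t w
  calc (coverCount (S.lmap w '' F) δ : ℝ) ≤ coverCount (projX '' F) r := by exact_mod_cast h3
    _ ≤ C₁ * r ^ (-(β + ε)) := hX r ⟨hr0, hrR⟩
    _ = C₁ * (4 * K) ^ (β + ε) * δ ^ (-(β + ε)) * (S.width w ^ β * S.width w ^ ε) := by
      rw [hr, Real.div_rpow hδ0.le (by positivity), Real.rpow_neg (x := 4 * K * S.width w)
        (by positivity), div_inv_eq_mul, Real.mul_rpow (by positivity) hW.le,
        Real.rpow_add hW]
      ring
    _ ≤ C₁ * (4 * K) ^ (β + ε) * δ ^ (-(β + ε)) * (S.width w ^ β * 1) := by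
      have := Real.rpow_le_one hW.le hW1 hε0.le
      gcongr
    _ ≤ C₁ * (4 * K) ^ (β + ε) * δ ^ (-(β + ε)) *
        (S.weight β t w * (A ^ |β - t| * δ ^ (β - t))) := by
      rw [mul_one, hWβ]
      gcongr
    _ = C * (δ ^ (-(β + ε)) * δ ^ (β - t)) * S.weight β t w := by rw [hC]; ring
    _ = C * δ ^ (-(t + ε)) * S.weight β t w := by
      rw [← Real.rpow_add hδ0]
      congr 3
      ring

theorem exists_finset_words_cover [Fintype I] (hF : S.IsAttractor F) {δ : ℝ}
    (hδ : δ ∈ Ioo (0 : ℝ) 1) : ∃ (k₀ : ℕ) (T : Finset (Σ k, Fin k → I)),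
      T ⊆ (Finset.range k₀).sigma (fun _ => Finset.univ) ∧
      (∀ q ∈ T, d / K * δ ≤ S.height (List.ofFn q.2) ∧ S.height (List.ofFn q.2) ≤ δ) ∧
      F ⊆ ⋃ q ∈ T, S.lmap (List.ofFn q.2) '' F := by
  classical
  have hpos : 0 < d / K * δ := mul_pos (div_pos h.d_pos h.K_pos) hδ.1
  obtain ⟨k₀, hk₀⟩ := exists_pow_lt_of_lt_one hpos h.c_lt_one
  refine ⟨k₀, ((Finset.range k₀).sigma fun _ => Finset.univ).filter fun q =>
    d / K * δ ≤ S.height (List.ofFn q.2) ∧ S.height (List.ofFn q.2) ≤ δ,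
    Finset.filter_subset _ _, fun q hq => (Finset.mem_filter.1 hq).2, fun x hx => ?_⟩
  obtain ⟨w, hxw, h1, h2⟩ := h.exists_word_height hF hδ hx
  have hlen : w.length < k₀ := by
    by_contra! hge
    have := pow_le_pow_of_le_one h.c_pos.le h.c_lt_one.le hge
    linarith [h.height_le_pow w]
  have e : List.ofFn w.get = w := List.ofFn_get w
  refine mem_iUnion₂.2 ⟨⟨w.length, w.get⟩, Finset.mem_filter.2
    ⟨Finset.mem_sigma.2 ⟨Finset.mem_range.2 hlen, Finset.mem_univ _⟩, ?_⟩, ?_⟩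
  · rw [e]
    exact ⟨h1, h2⟩
  · rw [e]
    exact hxw

/-- The covering words need not be incomparable: any finite set of words has total weight at most
the sum over all levels, which converges because L < 0. -/
theorem upperBoxDim_le [Fintype I] [Nonempty I] (hF : S.IsAttractor F) {β t s L : ℝ}
    (hβ : Tendsto (fun δ : ℝ => Real.log (coverCount (projX '' F) δ) / (-Real.log δ)) (𝓝[>] 0)
      (𝓝 β)) (hts : t < s) (hL0 : L < 0)
    (hL : Tendsto (fun k : ℕ => Real.log (S.levelSum β t k) / k) atTop (𝓝 L)) :
    upperBoxDim F ≤ (s : EReal) := by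
  have hK := h.K_pos
  have hK1 := h.one_le_K
  have hsum := h.summable_levelSum hL0 hL
  have hZ : 0 ≤ ∑' k, S.levelSum β t k := tsum_nonneg fun k => (h.levelSum_pos β t k).le
  obtain ⟨C, hC0, hterm⟩ := h.exists_coverCount_lmap_le hF t hβ (sub_pos.2 hts)
  refine upperBoxDim_le_of_coverCount_le hF.isCompact.totallyBounded hF.nonempty
    (C := C * (∑' k, S.levelSum β t k + 1)) (by positivity) ?_
  filter_upwards [eventually_Ioo_nhdsGT one_pos] with δ hδ
  have hδ0 := hδ.1
  obtain ⟨k₀, T, hT, hTb, hcov⟩ := h.exists_finset_words_cover hF (δ := δ / (2 * K))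
    ⟨by positivity, by rw [div_lt_one (by positivity)]; linarith [hδ.2]⟩
  have hle := coverCount_le_sum T (fun q => S.lmap (List.ofFn q.2) '' F)
    (fun q _ => (hF.isCompact_image_lmap _).totallyBounded) hcov hδ0
  have hs : -(t + (s - t)) = -s := by ring
  rw [hs] at hterm
  have hsub : ∑ q ∈ T, S.weight β t (List.ofFn q.2) ≤
      ∑ k ∈ Finset.range k₀, S.levelSum β t k := by
    simp only [levelSum]
    rw [Finset.sum_sigma']
    exact Finset.sum_le_sum_of_subset_of_nonneg hT fun q _ _ => (h.weight_pos β t _).le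
  have hrange := hsum.sum_le_tsum (Finset.range k₀) fun k _ => (h.levelSum_pos β t k).le
  calc (coverCount F δ : ℝ) ≤ ∑ q ∈ T, (coverCount (S.lmap (List.ofFn q.2) '' F) δ : ℝ) := by
        exact_mod_cast hle
    _ ≤ ∑ q ∈ T, C * δ ^ (-s) * S.weight β t (List.ofFn q.2) :=
        Finset.sum_le_sum fun q hq => hterm δ hδ0 _ (hTb q hq).1 (hTb q hq).2
    _ = C * δ ^ (-s) * ∑ q ∈ T, S.weight β t (List.ofFn q.2) := by rw [Finset.mul_sum]
    _ ≤ C * δ ^ (-s) * (∑' k, S.levelSum β t k + 1) := by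
        gcongr
        linarith
    _ = C * (∑' k, S.levelSum β t k + 1) * δ ^ (-s) := by ring

end WordBounds

end NonlinearIFS

/-! ### Bounded overlap under the rectangular open set condition. -/

namespace NonlinearIFS

variable {I : Type*} {S : NonlinearIFS I} {F : Set Plane}

theorem ROSC.lmap_mem (hR : S.ROSC) (w : List I) {a : Plane} (ha : a ∈ openUnitSquare) :
    S.lmap w a ∈ openUnitSquare := by
  induction w with
  | nil => exact ha
  | cons i w ih => exact hR.1 i ⟨_, ih, rfl⟩

namespace WordBounds

variable {d c K : ℝ} (h : S.WordBounds d c K)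
include h

/-- Injectivity strips common first letters; the first differing letters would give disjoint images.
-/
theorem eq_prefix_of_lmap_eq (hR : S.ROSC) : ∀ {u v : List I} {a b : Plane},
    a ∈ openUnitSquare → b ∈ openUnitSquare → S.lmap u a = S.lmap v b → u <+: v ∨ v <+: u
  | [], v, _, _, _, _, _ => Or.inl v.nil_prefix
  | i :: u, [], _, _, _, _, _ => Or.inr (i :: u).nil_prefix
  | i :: u, j :: v, a, b, ha, hb, hab => by
    have ha' := hR.lmap_mem u ha
    have hb' := hR.lmap_mem v hb
    have hij : i = j := by
      by_contra hne
      exact Set.disjoint_left.1 (hR.2 i j hne) ⟨_, ha', rfl⟩ ⟨_, hb', hab.symm⟩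
    subst hij
    have := h.injOn_lmap [i] (openUnitSquare_subset ha') (openUnitSquare_subset hb') hab
    simpa [List.cons_prefix_cons] using eq_prefix_of_lmap_eq hR ha hb this

/-- The image of the open square under `S_w` contains a square of size comparable to the height
of `w` in a neighbourhood of comparable size of any of its points. -/
theorem exists_square_subset {η : ℝ} (hη : 0 < η) : ∃ κ > 0, ∀ δ > 0, ∀ w,
    η * δ ≤ S.height w → S.height w ≤ δ → ∀ a ∈ unitSquare, ∃ z : Plane,
      (∀ j, |z j - S.lmap w a j| ≤ 2 * K * δ) ∧
      ∀ y : Plane, (∀ j, |y j - z j| < κ * δ) → y ∈ S.lmap w '' openUnitSquare := by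
  have hK := h.K_pos
  refine ⟨η / (8 * K * (1 + K ^ 2)), by positivity, fun δ hδ w hw1 hw2 a ha => ?_⟩
  set κ := η / (8 * K * (1 + K ^ 2)) with hκ
  have hκ0 : 0 < κ := by positivity
  have hκ1 : 8 * K * (κ * δ) * (1 + K ^ 2) = η * δ := by rw [hκ]; field_simp
  have hW := h.width_pos w
  have hH := h.height_pos w
  have hHW := h.height_le_width w
  set W := S.width w with hWdef
  set H := S.height w with hHdef
  have hη1 : η * δ ≤ W := hw1.trans hHW
  set t := η * δ / (4 * W) with ht
  have ht0 : 0 < t := by positivity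
  have ht1 : t ≤ 1 / 4 := by rw [ht, div_le_iff₀ (by positivity)]; linarith
  have hWt : W * t = η * δ / 4 := by rw [ht]; field_simp
  have ha0 := ha 0
  have ha1 := ha 1
  -- Clamping leaves room t on both sides of x₀ inside (0,1) and moves the abscissa by at most t.
  set x₀ := max t (min (1 - t) (a 0)) with hx₀
  have hx1 : t ≤ x₀ := le_max_left _ _
  have hx2 : x₀ ≤ 1 - t := max_le (by linarith) (min_le_left _ _)
  have hx3 : |x₀ - a 0| ≤ t := by
    rw [abs_le]
    constructor
    · rcases le_total (1 - t) (a 0) with hle | hle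
      · have : 1 - t ≤ x₀ := by rw [hx₀, min_eq_left hle]; exact le_max_right _ _
        linarith [ha0.2]
      · have : a 0 ≤ x₀ := by rw [hx₀, min_eq_right hle]; exact le_max_right _ _
        linarith
    · have : x₀ ≤ t + a 0 := max_le (by linarith [ha0.1])
        ((min_le_right _ _).trans (by linarith))
      linarith
  have hmem : ∀ x y : ℝ, x₀ - t / 2 ≤ x → x ≤ x₀ + t / 2 → 1 / 4 ≤ y → y ≤ 3 / 4 →
      (!₂[x, y] : Plane) ∈ openUnitSquare := fun x y h1 h2 h3 h4 =>
    vec_mem_openUnitSquare ⟨by linarith, by linarith⟩ ⟨by linarith, by linarith⟩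
  have hmem' := fun x y h1 h2 h3 h4 => openUnitSquare_subset (hmem x y h1 h2 h3 h4)
  have hb : (!₂[x₀, 1 / 2] : Plane) ∈ unitSquare :=
    hmem' _ _ (by linarith) (by linarith) (by norm_num) (by norm_num)
  have hHδ : K * H ≤ K * δ := mul_le_mul_of_nonneg_left hw2 hK.le
  have hKWt : K * W * |x₀ - a 0| ≤ K * (η * δ / 4) := by
    rw [← hWt, mul_assoc]
    gcongr
  have hηH : K * (η * δ) ≤ K * H := mul_le_mul_of_nonneg_left hw1 hK.le
  refine ⟨S.lmap w !₂[x₀, 1 / 2], Fin.forall_fin_two.2 ⟨?_, ?_⟩, fun y hy => ?_⟩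
  · have h1 : |S.lmap w !₂[x₀, 1 / 2] 0 - S.lmap w a 0| ≤ K * W * |x₀ - a 0| :=
      h.abs_fst_sub_le w hb ha
    have : 0 < K * δ := by positivity
    linarith
  · have h1 : |S.lmap w !₂[x₀, 1 / 2] 1 - S.lmap w a 1| ≤
        K * W * |x₀ - a 0| + K * H * |1 / 2 - a 1| := h.abs_snd_sub_le w hb ha
    have h2 : |1 / 2 - a 1| ≤ 1 / 2 := abs_le.2 ⟨by linarith [ha1.2], by linarith [ha1.1]⟩
    have h3 : K * H * |1 / 2 - a 1| ≤ K * H * (1 / 2) := by gcongr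
    have : 0 < K * δ := by positivity
    linarith
  have hy0 := abs_lt.1 (hy 0)
  have hy1 := abs_lt.1 (hy 1)
  set z := S.lmap w !₂[x₀, 1 / 2] with hz
  -- the first coordinate
  have hcx : ContinuousOn (fun x : ℝ => S.lmap w !₂[x, 1 / 2] 0)
      (Icc (x₀ - t / 2) (x₀ + t / 2)) := by
    have h1 : Continuous fun x : ℝ => (!₂[x, 1 / 2] : Plane) := by fun_prop
    exact (EuclideanSpace.proj 0 : Plane →L[ℝ] ℝ).continuous.comp_continuousOn
      ((continuousOn_lmap w).comp h1.continuousOn fun x hx =>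
        hmem' _ _ hx.1 hx.2 (by norm_num) (by norm_num))
  have hκK : K * (κ * δ) ≤ W * (t / 2) := by
    rw [show W * (t / 2) = W * t / 2 by ring, hWt]
    have : 0 ≤ K * (κ * δ) * K ^ 2 := by positivity
    linarith
  have hl : S.lmap w !₂[x₀ - t / 2, 1 / 2] 0 ≤ y 0 := by
    have h1 : W * (x₀ - (x₀ - t / 2)) ≤ K * (z 0 - S.lmap w !₂[x₀ - t / 2, 1 / 2] 0) :=
      h.mul_fst_le w (hmem' _ _ (by linarith) (by linarith) (by norm_num) (by norm_num)) hb
        (by simp; linarith)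
    have h2 : K * (κ * δ) ≤ K * (z 0 - S.lmap w !₂[x₀ - t / 2, 1 / 2] 0) := by linarith
    linarith [le_of_mul_le_mul_left h2 hK]
  have hr : y 0 ≤ S.lmap w !₂[x₀ + t / 2, 1 / 2] 0 := by
    have h1 : W * ((x₀ + t / 2) - x₀) ≤ K * (S.lmap w !₂[x₀ + t / 2, 1 / 2] 0 - z 0) :=
      h.mul_fst_le w hb (hmem' _ _ (by linarith) (by linarith) (by norm_num) (by norm_num))
        (by simp; linarith)
    have h2 : K * (κ * δ) ≤ K * (S.lmap w !₂[x₀ + t / 2, 1 / 2] 0 - z 0) := by linarith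
    linarith [le_of_mul_le_mul_left h2 hK]
  -- The first coordinate of S_w depends on x alone, so x can be fixed here and the second
  -- coordinate solved on the vertical line through it.
  obtain ⟨x, hx, hxy⟩ := intermediate_value_Icc (by linarith) hcx ⟨hl, hr⟩
  dsimp only at hxy
  have hq := hmem' x (1 / 2) hx.1 hx.2 (by norm_num) (by norm_num)
  have hxx₀ : K * (W * |x - x₀|) ≤ K * (K * (κ * δ)) := by
    have h1 : W * |x - x₀| ≤ K * |S.lmap w !₂[x, 1 / 2] 0 - z 0| := h.mul_abs_fst_le w hq hb
    rw [hxy] at h1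
    have := (hy 0).le
    exact mul_le_mul_of_nonneg_left (h1.trans (by gcongr)) hK.le
  have hq1 : |S.lmap w !₂[x, 1 / 2] 1 - z 1| ≤ K ^ 2 * (κ * δ) := by
    have h1 : |S.lmap w !₂[x, 1 / 2] 1 - z 1| ≤ K * W * |x - x₀| + K * H * |(1 / 2 : ℝ) - 1 / 2| :=
      h.abs_snd_sub_le w hq hb
    rw [sub_self, abs_zero, mul_zero, add_zero] at h1
    linarith
  have hq1' := abs_le.1 hq1
  -- the second coordinate
  have hcy : ContinuousOn (fun y : ℝ => S.lmap w !₂[x, y] 1) (Icc (1 / 4) (3 / 4)) := by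
    have h1 : Continuous fun y : ℝ => (!₂[x, y] : Plane) := by fun_prop
    exact (EuclideanSpace.proj 1 : Plane →L[ℝ] ℝ).continuous.comp_continuousOn
      ((continuousOn_lmap w).comp h1.continuousOn fun y hy => hmem' _ _ hx.1 hx.2 hy.1 hy.2)
  have hκK' : K * (κ * δ + K ^ 2 * (κ * δ)) ≤ H * (1 / 4) := by linarith
  have hl1 : S.lmap w !₂[x, 1 / 4] 1 ≤ y 1 := by
    have h1 : H * (1 / 2 - 1 / 4) ≤ K * (S.lmap w !₂[x, 1 / 2] 1 - S.lmap w !₂[x, 1 / 4] 1) :=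
      h.mul_snd_le w (hmem' _ _ hx.1 hx.2 (by norm_num) (by norm_num)) hq rfl (by norm_num)
    have h2 : K * (κ * δ + K ^ 2 * (κ * δ)) ≤
        K * (S.lmap w !₂[x, 1 / 2] 1 - S.lmap w !₂[x, 1 / 4] 1) := by linarith
    linarith [le_of_mul_le_mul_left h2 hK]
  have hr1 : y 1 ≤ S.lmap w !₂[x, 3 / 4] 1 := by
    have h1 : H * (3 / 4 - 1 / 2) ≤ K * (S.lmap w !₂[x, 3 / 4] 1 - S.lmap w !₂[x, 1 / 2] 1) :=
      h.mul_snd_le w hq (hmem' _ _ hx.1 hx.2 (by norm_num) (by norm_num)) rfl (by norm_num)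
    have h2 : K * (κ * δ + K ^ 2 * (κ * δ)) ≤
        K * (S.lmap w !₂[x, 3 / 4] 1 - S.lmap w !₂[x, 1 / 2] 1) := by linarith
    linarith [le_of_mul_le_mul_left h2 hK]
  obtain ⟨v, hv, hvy⟩ := intermediate_value_Icc (by norm_num) hcy ⟨hl1, hr1⟩
  refine ⟨!₂[x, v], hmem _ _ hx.1 hx.2 hv.1 hv.2, Plane.ext_coord ?_ hvy⟩
  rw [← hxy]
  exact lmap_zero_congr w rfl

-- Each cylinder meeting `U` has a full κδ-square inside its open image, centred within O(δ) of a
-- fixed point of `U`. Two centres in the same cell of side κδ give a common point of two open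
-- images, so the words are comparable, hence equal; it remains to count cells.
open Classical in
theorem exists_overlap_bound (hF : S.IsAttractor F) (hR : S.ROSC) {η : ℝ} (hη : 0 < η) :
    ∃ K₁ : ℕ, ∀ δ > 0, ∀ T : Finset (List I), IsAntichain (· <+: ·) (T : Set (List I)) →
      (∀ w ∈ T, η * δ ≤ S.height w ∧ S.height w ≤ δ) →
      ∀ U : Set Plane, Metric.ediam U ≤ ENNReal.ofReal δ →
        (T.filter fun w => (U ∩ S.lmap w '' F).Nonempty).card ≤ K₁ := by
  obtain ⟨κ, hκ, hsq⟩ := h.exists_square_subset hη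
  have hK := h.K_pos
  set R : ℤ := ⌈(2 * K + 1) / κ⌉ with hRdef
  refine ⟨(Finset.Icc (-R) R ×ˢ Finset.Icc (-R) R).card, fun δ hδ T hT hTb U hU => ?_⟩
  rcases (T.filter fun w => (U ∩ S.lmap w '' F).Nonempty).eq_empty_or_nonempty with he | ⟨w₀, hw₀⟩
  · rw [he]; simp
  obtain ⟨u₀, hu₀, -⟩ := (Finset.mem_filter.1 hw₀).2
  have hz : ∀ w, ∃ z : Plane, w ∈ T.filter (fun w => (U ∩ S.lmap w '' F).Nonempty) →
      (∀ j, |z j - u₀ j| ≤ (2 * K + 1) * δ) ∧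
      ∀ y : Plane, (∀ j, |y j - z j| < κ * δ) → y ∈ S.lmap w '' openUnitSquare := fun w => by
    by_cases hw : w ∈ T.filter (fun w => (U ∩ S.lmap w '' F).Nonempty)
    · obtain ⟨hwT, _, hu, a, ha, rfl⟩ := Finset.mem_filter.1 hw
      obtain ⟨z, hz1, hz2⟩ := hsq δ hδ w (hTb w hwT).1 (hTb w hwT).2 a (hF.subset ha)
      refine ⟨z, fun _ => ⟨fun j => ?_, hz2⟩⟩
      have h1 := (abs_sub_le_dist _ _ j).trans (dist_le_of_ediam_le hδ.le hU hu hu₀)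
      linarith [abs_sub_le (z j) (S.lmap w a j) (u₀ j), hz1 j]
    · exact ⟨0, fun hc => absurd hc hw⟩
  choose z hz using hz
  have hκδ : 0 < κ * δ := mul_pos hκ hδ
  refine Finset.card_le_card_of_injOn
    (fun w => (⌊(z w 0 - u₀ 0) / (κ * δ)⌋, ⌊(z w 1 - u₀ 1) / (κ * δ)⌋)) (fun w hw => ?_) ?_
  · have hb : ∀ j, ⌊(z w j - u₀ j) / (κ * δ)⌋ ∈ Finset.Icc (-R) R := fun j => by
      have h1 : |(z w j - u₀ j) / (κ * δ)| ≤ R := by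
        rw [abs_div, abs_of_pos hκδ]
        refine (div_le_div_of_nonneg_right ((hz w hw).1 j) hκδ.le).trans ?_
        rw [mul_div_mul_right _ _ hδ.ne']
        exact Int.le_ceil _
      have h2 := abs_le.1 h1
      rw [Finset.mem_Icc, Int.le_floor]
      refine ⟨by push_cast; exact h2.1, ?_⟩
      exact Int.cast_le.1 ((Int.floor_le _).trans h2.2)
    exact Finset.mem_coe.2 (Finset.mem_product.2 ⟨hb 0, hb 1⟩)
  · intro w hw v hv hwv
    have hwv' := Prod.ext_iff.1 hwv
    have hclose : ∀ j, ⌊(z w j - u₀ j) / (κ * δ)⌋ = ⌊(z v j - u₀ j) / (κ * δ)⌋ →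
        |z w j - z v j| < κ * δ := fun j hj => by
      have := Int.abs_sub_lt_one_of_floor_eq_floor hj
      rwa [← sub_div, sub_sub_sub_cancel_right, abs_div, abs_of_pos hκδ, div_lt_one hκδ] at this
    obtain ⟨a, ha, hae⟩ := (hz w hw).2 (z w) (fun j => by rw [sub_self, abs_zero]; exact hκδ)
    obtain ⟨b, hb, hbe⟩ := (hz v hv).2 (z w)
      (Fin.forall_fin_two.2 ⟨hclose 0 hwv'.1, hclose 1 hwv'.2⟩)
    have hwT := (Finset.mem_filter.1 hw).1
    have hvT := (Finset.mem_filter.1 hv).1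
    rcases h.eq_prefix_of_lmap_eq hR ha hb (hae.trans hbe.symm) with hp | hp
    · exact hT.eq hwT hvT hp
    · exact (hT.eq hvT hwT hp).symm

end WordBounds

end NonlinearIFS

/-! ### Antichains of large weight and the lower bound. -/

/-- The words of `T` on which `p` fails are replaced by their extensions by all words of length
`n`. -/
theorem exists_antichain_refinement {I : Type*} [Fintype I] (T : Finset (List I))
    (hT : IsAntichain (· <+: ·) (T : Set (List I))) (p : List I → Prop) (n : ℕ)
    (φ : List I → ℝ) (hφ : ∀ w, φ w ≤ ∑ v : Fin n → I, φ (w ++ List.ofFn v)) :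
    ∃ T' : Finset (List I), IsAntichain (· <+: ·) (T' : Set (List I)) ∧
      (∀ w ∈ T', (w ∈ T ∧ p w) ∨ ∃ u ∈ T, ¬ p u ∧ ∃ v : Fin n → I, w = u ++ List.ofFn v) ∧
      ∑ w ∈ T, φ w ≤ ∑ w ∈ T', φ w := by
  classical
  set ch : List I → Finset (List I) := fun w =>
    if p w then {w} else Finset.univ.image fun v : Fin n → I => w ++ List.ofFn v with hch
  have hpre : ∀ w, ∀ c ∈ ch w, w <+: c := fun w c hc => by
    by_cases hp : p w
    · simp only [hch, if_pos hp, Finset.mem_singleton] at hc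
      rw [hc]
    · simp only [hch, if_neg hp, Finset.mem_image, Finset.mem_univ, true_and] at hc
      obtain ⟨v, rfl⟩ := hc
      exact List.prefix_append _ _
  have huniq : ∀ w ∈ T, ∀ w' ∈ T, ∀ c, w <+: c → w' <+: c → w = w' := fun w hw w' hw' c h1 h2 => by
    rcases List.prefix_or_prefix_of_prefix h1 h2 with hp | hp
    · exact hT.eq hw hw' hp
    · exact (hT.eq hw' hw hp).symm
  have hinj : ∀ w : List I, Function.Injective fun v : Fin n → I => w ++ List.ofFn v :=
    fun w v v' hv => List.ofFn_injective (List.append_cancel_left hv)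
  refine ⟨T.biUnion ch, ?_, fun c hc => ?_, ?_⟩
  · intro c hc c' hc' hne hcc
    obtain ⟨w, hw, hcw⟩ := Finset.mem_biUnion.1 hc
    obtain ⟨w', hw', hcw'⟩ := Finset.mem_biUnion.1 hc'
    obtain rfl := huniq w hw w' hw' c' ((hpre w c hcw).trans hcc) (hpre w' c' hcw')
    refine hne ?_
    by_cases hp : p w
    · simp only [hch, if_pos hp, Finset.mem_singleton] at hcw hcw'
      rw [hcw, hcw']
    · simp only [hch, if_neg hp, Finset.mem_image, Finset.mem_univ, true_and] at hcw hcw'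
      obtain ⟨v, rfl⟩ := hcw
      obtain ⟨v', rfl⟩ := hcw'
      exact hcc.eq_of_length (by simp)
  · obtain ⟨w, hw, hcw⟩ := Finset.mem_biUnion.1 hc
    by_cases hp : p w
    · simp only [hch, if_pos hp, Finset.mem_singleton] at hcw
      exact Or.inl (hcw ▸ ⟨hw, hp⟩)
    · simp only [hch, if_neg hp, Finset.mem_image, Finset.mem_univ, true_and] at hcw
      obtain ⟨v, rfl⟩ := hcw
      exact Or.inr ⟨w, hw, hp, v, rfl⟩
  · rw [Finset.sum_biUnion]
    · refine Finset.sum_le_sum fun w _ => ?_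
      by_cases hp : p w
      · simp [hch, if_pos hp]
      · simp only [hch, if_neg hp]
        rw [Finset.sum_image (hinj w).injOn]
        exact hφ w
    · intro w hw w' hw' hne
      refine Finset.disjoint_left.2 fun c hc hc' => hne ?_
      exact huniq w hw w' hw' c (hpre w c hc) (hpre w' c hc')

namespace NonlinearIFS

variable {I : Type*} {S : NonlinearIFS I} {F : Set Plane}

namespace WordBounds

variable {d c K : ℝ} (h : S.WordBounds d c K)
include h

/-- Words taller than δ are repeatedly extended by all words of length `n`. The assumption on the
level sum cancels the distortion constant, so the total weight never drops; one extension costs at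
most a factor d^n/K in height. -/
theorem exists_antichain [Fintype I] {β t : ℝ} {n : ℕ} (hn : 0 < n)
    (hsum : K ^ |β| * K ^ |t - β| ≤ S.levelSum β t n) {δ : ℝ} (hδ : δ ∈ Ioo (0 : ℝ) 1) :
    ∃ T : Finset (List I), IsAntichain (· <+: ·) (T : Set (List I)) ∧
      (∀ w ∈ T, d ^ n / K * δ ≤ S.height w ∧ S.height w ≤ δ) ∧ 1 ≤ ∑ w ∈ T, S.weight β t w := by
  have hK := h.K_pos
  have hd := h.d_pos
  have hφ : ∀ w, S.weight β t w ≤ ∑ v : Fin n → I, S.weight β t (w ++ List.ofFn v) := fun w => by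
    have h1 : S.weight β t w * S.levelSum β t n ≤
        K ^ |β| * K ^ |t - β| * ∑ v : Fin n → I, S.weight β t (w ++ List.ofFn v) := by
      rw [levelSum, Finset.mul_sum, Finset.mul_sum]
      exact Finset.sum_le_sum fun v _ => h.le_weight_append β t w _
    have h2 := mul_le_mul_of_nonneg_left hsum (h.weight_pos β t w).le
    have hC : 0 < K ^ |β| * K ^ |t - β| := by positivity
    refine le_of_mul_le_mul_left ?_ hC
    linarith
  have key : ∀ m : ℕ, ∃ T : Finset (List I), IsAntichain (· <+: ·) (T : Set (List I)) ∧
      (∀ w ∈ T, (d ^ n / K * δ ≤ S.height w ∧ S.height w ≤ δ) ∨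
        (δ < S.height w ∧ m ≤ w.length)) ∧ 1 ≤ ∑ w ∈ T, S.weight β t w := by
    intro m
    induction m with
    | zero =>
      -- The empty word has weight 1 and height 1 > δ.
      refine ⟨{[]}, by simp [IsAntichain.singleton], fun w hw => Or.inr ?_, ?_⟩
      · rw [Finset.mem_singleton.1 hw]
        exact ⟨hδ.2, Nat.zero_le _⟩
      · simp [weight, width, height, cocycle]
    | succ m ih =>
      obtain ⟨T, hT, hTb, hT1⟩ := ih
      obtain ⟨T', hT', hTb', hT1'⟩ := exists_antichain_refinement T hT
        (fun w => S.height w ≤ δ) n (S.weight β t) hφ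
      refine ⟨T', hT', fun w hw => ?_, hT1.trans hT1'⟩
      rcases hTb' w hw with ⟨hwT, hwδ⟩ | ⟨u, hu, huδ, v, rfl⟩
      · rcases hTb w hwT with hb | hb
        · exact Or.inl hb
        · exact absurd hwδ (not_le.2 hb.1)
      · have hub := (hTb u hu).resolve_left fun hb => huδ hb.2
        rcases le_or_gt (S.height (u ++ List.ofFn v)) δ with hle | hgt
        · refine Or.inl ⟨?_, hle⟩
          have h1 := h.le_height_append u (List.ofFn v)
          have h2 := h.pow_le_height (List.ofFn v)
          rw [List.length_ofFn] at h2
          rw [div_mul_eq_mul_div, div_le_iff₀ hK]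
          calc d ^ n * δ ≤ S.height (List.ofFn v) * S.height u :=
                mul_le_mul h2 hub.1.le hδ.1.le (h.height_pos _).le
            _ ≤ _ := by linarith
        · refine Or.inr ⟨hgt, ?_⟩
          rw [List.length_append, List.length_ofFn]
          have := hub.2
          omega
  -- Words of length at least `m` have height below δ, so after `m` rounds none is still too tall.
  obtain ⟨m, hm⟩ := exists_pow_lt_of_lt_one hδ.1 h.c_lt_one
  obtain ⟨T, hT, hTb, hT1⟩ := key m
  refine ⟨T, hT, fun w hw => (hTb w hw).resolve_right fun hb => ?_, hT1⟩
  have h1 := h.height_le_pow w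
  have h2 := pow_le_pow_of_le_one h.c_pos.le h.c_lt_one.le hb.2
  linarith [hb.1]

theorem exists_le_coverCount_lmap (hF : S.IsAttractor F) {β : ℝ} (t : ℝ) {ε η : ℝ}
    (hβ : Tendsto (fun δ : ℝ => Real.log (coverCount (projX '' F) δ) / (-Real.log δ)) (𝓝[>] 0)
      (𝓝 β)) (hε : 0 < ε) (hη : 0 < η) (hη1 : η ≤ 1) : ∃ C > 0, ∀ δ > 0, ∀ w,
      η * δ ≤ S.height w → S.height w ≤ δ →
      C * δ ^ (-(t - ε)) * S.weight β t w ≤ (coverCount (S.lmap w '' F) δ : ℝ) := by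
  have hK := h.K_pos
  obtain ⟨C₁, hC₁, hX⟩ := exists_le_coverCount_of_tendsto hF.totallyBounded_projX
    (hF.nonempty.image _) hβ (t := β - ε) (by linarith) (K / η)
  have hA1 : 1 ≤ η⁻¹ := (one_le_inv₀ hη).2 hη1
  set A := η⁻¹ ^ |t - β| with hA
  have hA0 : 0 < A := by positivity
  set B := K ^ (-(β - ε)) with hB
  have hB0 : 0 < B := by positivity
  refine ⟨C₁ * B / A, by positivity, fun δ hδ w hw1 hw2 => ?_⟩
  have hH := h.height_pos w
  have hW := h.width_pos w
  have hHW := h.height_le_width w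
  -- The scale on πF that corresponds to δ on the projected cylinder. It is at most K/η, the range
  -- for which the power bound was obtained.
  set r := K * δ / S.width w with hr
  have hr0 : 0 < r := by positivity
  have hrR : r ≤ K / η := by
    rw [hr, div_le_div_iff₀ hW hη]
    have := mul_le_mul_of_nonneg_left (hw1.trans hHW) hK.le
    linarith
  have h1 : coverCount (projX '' F) r ≤ coverCount (projX '' (S.lmap w '' F)) δ :=
    h.coverCount_projX_le hF w hδ (by rw [hr]; field_simp; exact le_rfl)
  have h2 : coverCount (projX '' (S.lmap w '' F)) δ ≤ coverCount (S.lmap w '' F) δ := by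
    have := coverCount_image_le (A := S.lmap w '' F) id projX hδ
      (by simpa using (hF.isCompact_image_lmap w).totallyBounded)
      (fun a _ b _ hab => (abs_sub_le_dist a b 0).trans hab)
    simpa using this
  have hcmp : S.height w ^ (t - β) ≤ A * δ ^ (t - β) := by
    refine Real.rpow_le_of_comparable hH hδ hA1 ?_ ?_ _
    · nlinarith
    · rwa [← div_eq_inv_mul, le_div_iff₀ hη, mul_comm]
  calc C₁ * B / A * δ ^ (-(t - ε)) * S.weight β t w
      ≤ C₁ * B / A * δ ^ (-(t - ε)) * (S.width w ^ β * (A * δ ^ (t - β))) := by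
        rw [weight]
        gcongr
    _ = C₁ * B * (δ ^ (-(t - ε)) * δ ^ (t - β)) * (S.width w ^ β * 1) := by
        field_simp
    _ ≤ C₁ * B * (δ ^ (-(t - ε)) * δ ^ (t - β)) * (S.width w ^ β * S.width w ^ (-ε)) := by
        have := Real.one_le_rpow_of_pos_of_le_one_of_nonpos hW (h.width_le_one w)
          (neg_nonpos.2 hε.le)
        gcongr
    _ = C₁ * r ^ (-(β - ε)) := by
        rw [← Real.rpow_add hδ, ← Real.rpow_add hW, hr, Real.div_rpow (by positivity) hW.le,
          Real.mul_rpow hK.le hδ.le, Real.rpow_neg (x := S.width w) hW.le, div_inv_eq_mul,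
          show -(t - ε) + (t - β) = -(β - ε) by ring, show β + -ε = β - ε by ring]
        ring
    _ ≤ coverCount (projX '' F) r := hX r ⟨hr0, hrR⟩
    _ ≤ coverCount (S.lmap w '' F) δ := by exact_mod_cast h1.trans h2

theorem exists_le_levelSum [Fintype I] [Nonempty I] {β t L : ℝ} (hL0 : 0 < L)
    (hL : Tendsto (fun k : ℕ => Real.log (S.levelSum β t k) / k) atTop (𝓝 L)) (M : ℝ) :
    ∃ n, 0 < n ∧ M ≤ S.levelSum β t n := by
  have h1 : Tendsto (fun k : ℕ => (k : ℝ) * (Real.log (S.levelSum β t k) / k)) atTop atTop :=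
    tendsto_natCast_atTop_atTop.atTop_mul_pos hL0 hL
  obtain ⟨n, hn, hn0⟩ := ((h1.eventually_ge_atTop M).and (eventually_gt_atTop 0)).exists
  refine ⟨n, hn0, ?_⟩
  have hn0' : (n : ℝ) ≠ 0 := by exact_mod_cast hn0.ne'
  rw [mul_div_cancel₀ _ hn0'] at hn
  have := Real.add_one_le_exp (Real.log (S.levelSum β t n))
  rw [Real.exp_log (h.levelSum_pos β t n)] at this
  linarith

theorem le_lowerBoxDim [Fintype I] [Nonempty I] (hF : S.IsAttractor F) (hR : S.ROSC)
    {β t s L : ℝ}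
    (hβ : Tendsto (fun δ : ℝ => Real.log (coverCount (projX '' F) δ) / (-Real.log δ)) (𝓝[>] 0)
      (𝓝 β)) (hst : s < t) (hL0 : 0 < L)
    (hL : Tendsto (fun k : ℕ => Real.log (S.levelSum β t k) / k) atTop (𝓝 L)) :
    (s : EReal) ≤ lowerBoxDim F := by
  have hK := h.K_pos
  have hd := h.d_pos
  obtain ⟨n, hn, hsum⟩ := h.exists_le_levelSum hL0 hL (K ^ |β| * K ^ |t - β|)
  have hη : 0 < d ^ n / K := by positivity
  have hη1 : d ^ n / K ≤ 1 := by
    rw [div_le_one hK]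
    exact (pow_le_one₀ hd.le h.d_le_one).trans h.one_le_K
  obtain ⟨C, hC, hterm⟩ := h.exists_le_coverCount_lmap hF t hβ (sub_pos.2 hst) hη hη1
  obtain ⟨K₁, hK₁⟩ := h.exists_overlap_bound hF hR hη
  refine le_lowerBoxDim_of_le_coverCount (C := C / (K₁ + 1)) (by positivity) ?_
  filter_upwards [eventually_Ioo_nhdsGT one_pos] with δ hδ
  have hδ0 := hδ.1
  obtain ⟨T, hT, hTb, hT1⟩ := h.exists_antichain hn hsum hδ
  have h1 := sum_coverCount_le hF.isCompact.totallyBounded T (fun w => S.lmap w '' F)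
    (fun w _ => hF.lmap_image_subset w) hδ0 K₁ (fun U hU => by
      convert hK₁ δ hδ0 T hT hTb U hU)
  have h2 : (∑ w ∈ T, (coverCount (S.lmap w '' F) δ : ℝ)) ≤ K₁ * coverCount F δ := by
    exact_mod_cast h1
  have e : -(t - (t - s)) = -s := by ring
  rw [e] at hterm
  have h3 : C * δ ^ (-s) ≤ K₁ * coverCount F δ := by
    calc C * δ ^ (-s) = C * δ ^ (-s) * 1 := by ring
      _ ≤ C * δ ^ (-s) * ∑ w ∈ T, S.weight β t w := by gcongr
      _ = ∑ w ∈ T, C * δ ^ (-s) * S.weight β t w := by rw [Finset.mul_sum]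
      _ ≤ ∑ w ∈ T, (coverCount (S.lmap w '' F) δ : ℝ) :=
          Finset.sum_le_sum fun w hw => hterm δ hδ0 w (hTb w hw).1 (hTb w hw).2
      _ ≤ _ := h2
  rw [div_mul_eq_mul_div, div_le_iff₀ (by positivity)]
  have : (0 : ℝ) ≤ coverCount F δ := Nat.cast_nonneg _
  linarith

end WordBounds

end NonlinearIFS
-- Conclusion.
theorem mainTheorem2 {I : Type*} [Fintype I] (hI : 2 ≤ Fintype.card I)
    (S : NonlinearIFS I) (hS : S.Dominated) (F : Set Plane) (hF : S.IsAttractor F) :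
    ∃ β₀ γ₀ : ℝ,
      HasBoxDim (projX '' F) β₀ ∧
      (∀ (p : I → ℝ) (μ : Measure Plane), IsProbVector p → S.IsNonlinearMeasure F p μ →
        HasLqSpectrum (μ.map projX) 0 β₀) ∧
      (∀ p : I → ℝ, IsProbVector p → S.IsMomentScaling p β₀ 0 γ₀) ∧
      upperBoxDim F ≤ (γ₀ : EReal) ∧
      (S.ROSC → HasBoxDim F γ₀) := by
  have : Nonempty I := Fintype.card_pos_iff.1 (by omega)
  obtain ⟨d, c, ρ, M, B, θ, hl⟩ := hS.exists_letterBounds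
  obtain ⟨K, h⟩ := hl.exists_wordBounds
  obtain ⟨β, hβ⟩ := h.exists_tendsto_projX hF
  obtain ⟨L, γ, hL, hγ, hpos, hneg⟩ := h.exists_pressure β
  -- The midpoint t of γ and s leaves room on both sides: L(t) < 0, and s - t is the ε lost in the
  -- covering estimate.
  have hupper : upperBoxDim F ≤ (γ : EReal) := EReal.le_of_forall_lt_iff_le.1 fun s hs => by
    have hs' := EReal.coe_lt_coe_iff.1 hs
    exact h.upperBoxDim_le hF hβ (t := (γ + s) / 2) (by linarith) (hneg _ (by linarith)) (hL _)
  refine ⟨β, γ, hasBoxDim_of_tendsto hβ,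
    fun p μ hp hμ => h.hasLqSpectrum_zero hF (fun i => (hp.1 i).1) hμ hβ,
    fun p _ => h.isMomentScaling_zero p hL hγ, hupper, fun hR => ?_⟩
  have hlower : (γ : EReal) ≤ lowerBoxDim F := EReal.ge_of_forall_gt_iff_ge.1 fun s hs => by
    have hs' := EReal.coe_lt_coe_iff.1 hs
    exact h.le_lowerBoxDim hF hR hβ (t := (γ + s) / 2) (by linarith) (hpos _ (by linarith)) (hL _)
  have hle := lowerBoxDim_le_upperBoxDim F
  exact ⟨le_antisymm hupper (hlower.trans hle), le_antisymm (hle.trans hupper) hlower⟩
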